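/- Let $n\ge 3$, let $M$ be a smooth (Hausdorff, second countable, boundaryless) $n$-dimensional manifold, $g$ a smooth Riemannian metric on $M$ and $c=[g]=\{e^{2u}g : u\in C^\infty(M)\}$ its conformal class. For a metric $h$ on $M$ let $$P^{h}=\frac{1}{n-2}\Big(\mathrm{Ric}^{h}-\frac{\mathrm{scal}^{h}}{2(n-1)}\,h\Big)$$ be its Schouten tensor, and let $\widehat P^{g}$ be the endomorphism field with $g(\widehat P^{g}V,W)=P^{g}(V,W)$. Let $\varepsilon>0$ and let $\alpha(\rho)$, $|\rho|<\varepsilon$, be a family of $(1,1)$-tensor fields on $M$, smooth in $(\rho,x)\in(-\varepsilon,\varepsilon)\times M$, such that each $\alpha(\rho)$ is self-adjoint with respect to $g$, $g(\alpha(\rho)\,\cdot,\cdot)$ is positive definite, $\alpha(0)=\mathrm{Id}$ and $\dot\alpha(0)=2\widehat P^{g}$. On $\widetilde M=(0,\infty)\times(-\varepsilon,\varepsilon)\times M$, with coordinates $(t,\rho)$ on the first two factors, consider the Lorentzian metric $$\widetilde g=d(\rho t)\otimes dt+dt\otimes d(\rho t)+t^{2}\,g(\alpha(\rho)\,\cdot,\cdot).$$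 For $u\in C^\infty(M)$ consider the spacelike immersion $\Psi^{u}:M\to\widetilde M$, $\Psi^u(x)=(e^{u(x)},0,x)$ (which satisfies $(\Psi^u)^*\widetilde g=e^{2u}g$), and the lightlike normal vector field $$\eta^{u}=e^{-u}\frac{\|\nabla^{g}u\|_{g}^{2}}{2}\,\partial_t-e^{-2u}\,\partial_\rho+e^{-2u}\,\nabla^{g}u$$ along $\Psi^u$. Let $A_{\eta^u}$ be its Weingarten endomorphism: $-T\Psi^u(A_{\eta^u}V)$ is the tangential part of $\widetilde\nabla_V\eta^u$, where $\widetilde\nabla$ is the Levi-Civita connection of $\widetilde g$. Let $\mathcal Q\to M$ be the scale bundle of $c$, whose fibre over $x$ is $\{h_x : h\in c\}=\{t^2g_x : t>0\}$, with the smooth structure for which $t^2g_x\mapsto(t,x)$ is a diffeomorphism onto $(0,\infty)\times M$, and let $\iota_g:\mathcal Q\to\widetilde M$, $\iota_g(t^2g_x)=(t,0,x)$. Then for every $u\in C^\infty(M)$ the Schouten tensor of $e^{2u}g$ is $$P^{e^{2u}g}(V,W)=e^{2u}g(A_{\eta^u}(V),W)\qquad\text{for all } V,W\in\mathfrak X(M).$$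 Moreover, the Ricci tensor of $\widetilde g$ satisfies $\widetilde{\mathrm{Ric}}(T\iota_g\cdot\xi,\,T\iota_g\cdot\zeta)=0$ for all $q\in\mathcal Q$ and all $\xi,\zeta\in T_q\mathcal Q$. -/

import Mathlib

open Bundle Set
open scoped Manifold ContDiff Topology

namespace ConformalAmbient

/-! ### Linear algebra -/

section LinearAlgebra

set_option linter.unusedSectionVars false

variable {V W : Type*}
  [AddCommGroup V] [Module ℝ V] [TopologicalSpace V] [IsTopologicalAddGroup V]
  [ContinuousConstSMul ℝ V]
  [AddCommGroup W] [Module ℝ W] [TopologicalSpace W] [IsTopologicalAddGroup W]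
  [ContinuousConstSMul ℝ W]

/-- The bilinear form `(v, w) ↦ B (A v) (C w)`. -/
noncomputable def compForm (B : W →L[ℝ] W →L[ℝ] ℝ) (A C : V →L[ℝ] W) : V →L[ℝ] V →L[ℝ] ℝ :=
  (ContinuousLinearMap.precomp ℝ C ∘L B) ∘L A

theorem compForm_apply (B : W →L[ℝ] W →L[ℝ] ℝ) (A C : V →L[ℝ] W) (v w : V) :
    compForm B A C v w = B (A v) (C w) := rfl

/-- The product of covectors `φ ⊗ ψ`, i.e. `(v, w) ↦ φ v * ψ w`. -/
noncomputable def tensor (φ ψ : V →L[ℝ] ℝ) : V →L[ℝ] V →L[ℝ] ℝ :=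
  φ.smulRight ψ

theorem tensor_apply (φ ψ : V →L[ℝ] ℝ) (v w : V) : tensor φ ψ v w = φ v * ψ w := rfl

/-- Raising the first index of the form `S` with the (nondegenerate, symmetric) form `B`: the
endomorphism `A` with `B (A v) w = S v w`. -/
noncomputable def raise (B S : V →L[ℝ] V →L[ℝ] ℝ) : V →L[ℝ] V :=
  B.inverse ∘L S

end LinearAlgebra

/-! ### Levi-Civita connection and curvature of a metric on a vector space

A metric on (an open subset of) the vector space `E` is a function `G : E → (E →L E →L ℝ)`. -/

section Coordinates

variable {E : Type*} [NormedAddCommGroup E] [NormedSpace ℝ E]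

/-- Exchanging the two arguments of a bilinear map, as a continuous linear map. -/
noncomputable def flipL (E F : Type*) [NormedAddCommGroup E] [NormedSpace ℝ E]
    [NormedAddCommGroup F] [NormedSpace ℝ F] :
    (E →L[ℝ] E →L[ℝ] F) →L[ℝ] (E →L[ℝ] E →L[ℝ] F) :=
  (ContinuousLinearMap.flipₗᵢ ℝ E E F).toContinuousLinearEquiv

theorem flipL_apply (F : Type*) [NormedAddCommGroup F] [NormedSpace ℝ F]
    (B : E →L[ℝ] E →L[ℝ] F) (v w : E) : flipL E F B v w = B w v := rfl

/-- The trilinear map `(v, w, z) ↦ (D v w z + D w v z - D z v w) / 2`. -/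
noncomputable def koszul {F : Type*} [NormedAddCommGroup F] [NormedSpace ℝ F]
    (D : E →L[ℝ] E →L[ℝ] E →L[ℝ] F) : E →L[ℝ] E →L[ℝ] E →L[ℝ] F :=
  (1 / 2 : ℝ) • (D + flipL E (E →L[ℝ] F) D - flipL E F ∘L flipL E (E →L[ℝ] F) D)

theorem koszul_apply {F : Type*} [NormedAddCommGroup F] [NormedSpace ℝ F]
    (D : E →L[ℝ] E →L[ℝ] E →L[ℝ] F) (v w z : E) :
    koszul D v w z = (1 / 2 : ℝ) • (D v w z + D w v z - D z v w) := rfl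

/-- The Christoffel symbols of `G` at `e`: `christoffel G e v w` is the covariant derivative
`∇_v w` at `e` of the constant vector field `w` in the direction `v`, given by the Koszul formula
`G(∇_v w, z) = (D_v G(w, z) + D_w G(v, z) - D_z G(v, w)) / 2`. -/
noncomputable def christoffel (G : E → E →L[ℝ] E →L[ℝ] ℝ) (e : E) : E →L[ℝ] E →L[ℝ] E :=
  ContinuousLinearMap.compL ℝ E (E →L[ℝ] ℝ) E (G e).inverse ∘L koszul (fderiv ℝ G e)

theorem christoffel_apply (G : E → E →L[ℝ] E →L[ℝ] ℝ) (e v w z : E)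
    (h : (G e).IsInvertible) :
    G e (christoffel G e v w) z =
      (1 / 2) * (fderiv ℝ G e v w z + fderiv ℝ G e w v z - fderiv ℝ G e z v w) := by
  have h1 : G e (christoffel G e v w) = koszul (fderiv ℝ G e) v w := by simp [christoffel, h]
  rw [h1]
  simp [koszul_apply]

/-- The curvature tensor `R(u, v) w = ∇_u ∇_v w - ∇_v ∇_u w - ∇_[u, v] w` of `G` at `e`, computed
with constant vector fields `u`, `v`, `w`. -/
noncomputable def coordCurvature (G : E → E →L[ℝ] E →L[ℝ] ℝ) (e : E) :
    E →L[ℝ] E →L[ℝ] E →L[ℝ] E :=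
  let A : E →L[ℝ] E →L[ℝ] E →L[ℝ] E := fderiv ℝ (christoffel G) e +
    (ContinuousLinearMap.compL ℝ E E E).bilinearComp (christoffel G e) (christoffel G e)
  A - A.flip

theorem coordCurvature_apply (G : E → E →L[ℝ] E →L[ℝ] ℝ) (e u v w : E) :
    coordCurvature G e u v w =
      fderiv ℝ (christoffel G) e u v w + christoffel G e u (christoffel G e v w)
        - (fderiv ℝ (christoffel G) e v u w + christoffel G e v (christoffel G e u w)) := rfl

variable [FiniteDimensional ℝ E]

/-- The trace, as a continuous linear form on the endomorphisms of `E`. -/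
noncomputable def traceL : (E →L[ℝ] E) →L[ℝ] ℝ :=
  LinearMap.toContinuousLinearMap (LinearMap.trace ℝ E ∘ₗ ContinuousLinearMap.coeLM ℝ)

/-- The Ricci tensor `Ric(v, w) = trace (u ↦ R(u, v) w)` of `G` at `e`. -/
noncomputable def coordRicci (G : E → E →L[ℝ] E →L[ℝ] ℝ) (e : E) : E →L[ℝ] E →L[ℝ] ℝ :=
  ContinuousLinearMap.compL ℝ E (E →L[ℝ] E) ℝ traceL ∘L flipL E E ∘L (coordCurvature G e).flip

theorem coordRicci_apply (G : E → E →L[ℝ] E →L[ℝ] ℝ) (e v w : E) :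
    coordRicci G e v w =
      LinearMap.trace ℝ E (((coordCurvature G e).flip v).flip w : E →L[ℝ] E) := rfl

end Coordinates

/-! ### Semi-Riemannian geometry on a manifold without boundary -/

section Manifold

variable {E : Type*} [NormedAddCommGroup E] [NormedSpace ℝ E]
  {H : Type*} [TopologicalSpace H] (I : ModelWithCorners ℝ E H)
  {M : Type*} [TopologicalSpace M] [ChartedSpace H M]
  {E' : Type*} [NormedAddCommGroup E'] [NormedSpace ℝ E']
  {H' : Type*} [TopologicalSpace H'] (I' : ModelWithCorners ℝ E' H')
  {M' : Type*} [TopologicalSpace M'] [ChartedSpace H' M']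

variable (M) in
/-- Fields of bilinear forms on the tangent spaces of `M`, i.e. tensor fields of type `(0, 2)`. -/
abbrev FormField := ∀ x : M, TangentSpace I x →L[ℝ] TangentSpace I x →L[ℝ] ℝ

/-- The pull-back `f^* g`, i.e. `(v, w) ↦ g (Tf v, Tf w)`. -/
noncomputable def pullback (f : M → M') (g : FormField I' M') : FormField I M := fun x =>
  compForm (g (f x)) (mfderiv I I' f x) (mfderiv I I' f x)

/-- The expression of the metric `g` in the chart of `M` around `x`: its pull-back under the
inverse of the chart. -/
noncomputable def coordMetric (g : FormField I M) (x : M) : E → E →L[ℝ] E →L[ℝ] ℝ :=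
  pullback 𝓘(ℝ, E) I (extChartAt I x).symm g

/-- The Ricci tensor of the metric `g`: at `x` it is computed in the chart around `x`. -/
noncomputable def ricci [FiniteDimensional ℝ E] (g : FormField I M) : FormField I M := fun x =>
  compForm (W := E) (coordRicci (coordMetric I g x) (extChartAt I x x))
    (mfderiv I 𝓘(ℝ, E) (extChartAt I x) x) (mfderiv I 𝓘(ℝ, E) (extChartAt I x) x)

/-- The scalar curvature, the trace of the Ricci tensor with respect to `g`. -/
noncomputable def scalarCurvature [FiniteDimensional ℝ E] (g : FormField I M) (x : M) : ℝ :=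
  LinearMap.trace ℝ (TangentSpace I x)
    (raise (g x) (ricci I g x) : TangentSpace I x →L[ℝ] TangentSpace I x)

/-- The Schouten tensor `(Ric - scal / (2 (n - 1)) g) / (n - 2)` in dimension `n ≥ 3`. -/
noncomputable def schouten [FiniteDimensional ℝ E] (g : FormField I M) : FormField I M := fun x =>
  (1 / ((Module.finrank ℝ E : ℝ) - 2)) •
    (ricci I g x - (scalarCurvature I g x / (2 * ((Module.finrank ℝ E : ℝ) - 1))) • g x)

/-- The gradient of the function `u` with respect to the metric `g`. -/
noncomputable def grad (g : FormField I M) (u : M → ℝ) (x : M) : TangentSpace I x :=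
  (g x).inverse (mfderiv I 𝓘(ℝ, ℝ) u x)

/-- The metric `e^{2u} g`. -/
noncomputable def conformalForm (g : FormField I M) (u : M → ℝ) : FormField I M := fun x =>
  Real.exp (2 * u x) • g x

/-- The induced covariant derivative `v ↦ ∇_v N` at `x` of a vector field `N` along the map
`Ψ : M → M'`, for the Levi-Civita connection `∇` of the metric `g` on `M'`. In the chart `φ` of `M'`
around `Ψ x` it is `D_v N + Γ(TΨ v, N)`. -/
noncomputable def inducedDeriv (g : FormField I' M') (Ψ : M → M')
    (N : ∀ x : M, TangentSpace I' (Ψ x)) (x : M) :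
    TangentSpace I x →L[ℝ] TangentSpace I' (Ψ x) :=
  let φ : M' → E' := extChartAt I' (Ψ x)
  let Nφ : M → E' := fun y => mfderiv I' 𝓘(ℝ, E') φ (Ψ y) (N y)
  let Γ : E' →L[ℝ] E' →L[ℝ] E' := christoffel (coordMetric I' g (Ψ x)) (φ (Ψ x))
  let DN : TangentSpace I x →L[ℝ] E' := mfderiv I 𝓘(ℝ, E') Nφ x
  let DΨ : TangentSpace I x →L[ℝ] E' := mfderiv I 𝓘(ℝ, E') (φ ∘ Ψ) x
  let back : E' →L[ℝ] TangentSpace I' (Ψ x) :=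
    mfderiv 𝓘(ℝ, E') I' (extChartAt I' (Ψ x)).symm (φ (Ψ x))
  back ∘L (DN + Γ.flip (Nφ x) ∘L DΨ)

/-- The Weingarten endomorphism `A_N` of a normal vector field `N` along the immersion
`Ψ : M → (M', g)` with nondegenerate induced metric: `TΨ (A_N v)` is minus the tangent part of
`∇_v N`, i.e. `(Ψ^* g) (A_N v, w) = - g (∇_v N, TΨ w)` for all `w`. -/
noncomputable def weingarten (g : FormField I' M') (Ψ : M → M')
    (N : ∀ x : M, TangentSpace I' (Ψ x)) (x : M) : TangentSpace I x →L[ℝ] TangentSpace I x :=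
  -raise (pullback I I' Ψ g x)
    (compForm (g (Ψ x)) (inducedDeriv I I' g Ψ N x) (mfderiv I I' Ψ x))

theorem weingarten_apply (g : FormField I' M') (Ψ : M → M')
    (N : ∀ x : M, TangentSpace I' (Ψ x)) (x : M) (h : (pullback I I' Ψ g x).IsInvertible)
    (v w : TangentSpace I x) :
    g (Ψ x) (inducedDeriv I I' g Ψ N x v + mfderiv I I' Ψ x (weingarten I I' g Ψ N x v))
      (mfderiv I I' Ψ x w) = 0 := by
  have h1 : pullback I I' Ψ g x (weingarten I I' g Ψ N x v) =
      -compForm (g (Ψ x)) (inducedDeriv I I' g Ψ N x) (mfderiv I I' Ψ x) v := by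
    simp [weingarten, raise, h]
  have h2 := congrArg (fun φ : TangentSpace I x →L[ℝ] ℝ => φ w) h1
  simp only [pullback, compForm_apply, neg_apply] at h2
  simp [h2]

end Manifold

/-! ### Riemannian metrics and the scale bundle of a conformal class -/

section Scale

variable {E : Type*} [NormedAddCommGroup E] [NormedSpace ℝ E]
  {H : Type*} [TopologicalSpace H] {I : ModelWithCorners ℝ E H}
  {M : Type*} [TopologicalSpace M] [ChartedSpace H M] [IsManifold I ∞ M]

variable (I M) in
/-- Smooth Riemannian metrics on `M`. -/
abbrev RiemannianMetricOn := ContMDiffRiemannianMetric I ∞ E (fun x : M => TangentSpace I x)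

/-- The Riemannian metric `e^{2u} g`. -/
noncomputable def conformal (g : RiemannianMetricOn I M) (u : C^∞⟮I, M; ℝ⟯) :
    RiemannianMetricOn I M where
  inner := conformalForm I g.inner u
  symm x v w := by simp [conformalForm, g.symm x v w]
  pos x v hv := by
    have := g.pos x v hv
    simp only [conformalForm, smul_apply, smul_eq_mul]
    positivity
  isVonNBounded x := by
    have h := (g.isVonNBounded x).image
      (Real.exp (-u x) • ContinuousLinearMap.id ℝ (TangentSpace I x))
    refine h.subset fun (v : TangentSpace I x) hv => (mem_image _ _ _).2 ⟨Real.exp (u x) • v, ?_, ?_⟩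
    · simp only [mem_ofPred_eq, conformalForm, smul_apply, smul_eq_mul,
        map_smul] at hv ⊢
      rw [← mul_assoc, ← Real.exp_add, ← two_mul]
      exact hv
    · simp [smul_smul, ← Real.exp_add]
  contMDiff := by
    have hu : ContMDiff I 𝓘(ℝ, ℝ) ∞ (fun x => Real.exp (2 * u x)) :=
      (Real.contDiff_exp.comp (contDiff_const.mul contDiff_id)).contMDiff.comp u.contMDiff
    exact hu.smul_section g.contMDiff

/-- The conformal class `[g] = {e^{2u} g | u smooth}`. -/
def conformalClass (g : RiemannianMetricOn I M) : Set (RiemannianMetricOn I M) :=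
  {g' | ∃ u : C^∞⟮I, M; ℝ⟯, g' = conformal g u}

/-- The scale bundle of `[g]`: its points are the pairs of a point `x` of `M` and a value at `x` of
a metric of the conformal class of `g`. -/
def ScaleBundle (g : RiemannianMetricOn I M) : Type _ :=
  {q : Σ x : M, (TangentSpace I x →L[ℝ] TangentSpace I x →L[ℝ] ℝ) //
    ∃ g' ∈ conformalClass g, q.2 = g'.inner q.1}

/-- The positive reals, as a manifold. -/
abbrev PosReal : TopologicalSpace.Opens ℝ := ⟨Ioi 0, isOpen_Ioi⟩

/-- The point `t^2 g_x` of the scale bundle. -/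
noncomputable def scalePoint (g : RiemannianMetricOn I M) (p : PosReal × M) : ScaleBundle g :=
  ⟨⟨p.2, ((p.1 : ℝ) ^ 2) • g.inner p.2⟩,
    conformal g ⟨fun _ => Real.log p.1, contMDiff_const⟩, ⟨_, rfl⟩, by
      have hp : (0 : ℝ) < p.1 := p.1.2
      have : Real.exp (2 * Real.log p.1) = (p.1 : ℝ) ^ 2 := by
        rw [mul_comm, Real.exp_mul, Real.exp_log hp]; norm_num
      simp [conformal, conformalForm, this]⟩

theorem scalePoint_bijective [Nontrivial E] (g : RiemannianMetricOn I M) :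
    Function.Bijective (scalePoint g) := by
  constructor
  · rintro ⟨t, x⟩ ⟨s, y⟩ h
    have h1 := congrArg Subtype.val h
    simp only [scalePoint, Sigma.mk.injEq] at h1
    obtain ⟨rfl, h2⟩ := h1
    have h2 := eq_of_heq h2
    have : Nontrivial (TangentSpace I x) := inferInstanceAs (Nontrivial E)
    obtain ⟨v, hv⟩ := exists_ne (0 : TangentSpace I x)
    have h3 := congrArg (fun B : TangentSpace I x →L[ℝ] TangentSpace I x →L[ℝ] ℝ => B v v) h2
    simp only [smul_apply, smul_eq_mul] at h3
    have h4 := mul_right_cancel₀ (g.pos x v hv).ne' h3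
    have ht : (0 : ℝ) < t := t.2
    have hs : (0 : ℝ) < s := s.2
    have : t = s := Subtype.ext ((pow_left_inj₀ ht.le hs.le two_ne_zero).1 h4)
    rw [this]
  · rintro ⟨⟨x, b⟩, g', ⟨u, rfl⟩, hb⟩
    refine ⟨(⟨Real.exp (u x), Real.exp_pos _⟩, x), Subtype.ext ?_⟩
    simp only [scalePoint]
    dsimp only at hb
    rw [hb, ← Real.exp_nat_mul]
    simp [conformal, conformalForm]

/-- The global trivialization `t^2 g_x ↦ (t, x)` of the scale bundle. -/
noncomputable def scaleTriv [Nontrivial E] (g : RiemannianMetricOn I M) :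
    ScaleBundle g ≃ PosReal × M :=
  (Equiv.ofBijective _ (scalePoint_bijective g)).symm

/-- The manifold structure of the scale bundle is the one for which the global trivialization is a
diffeomorphism. -/
noncomputable instance [Nontrivial E] (g : RiemannianMetricOn I M) : TopologicalSpace (ScaleBundle g) :=
  TopologicalSpace.induced (scaleTriv g) inferInstance

/-- The trivialization as a homeomorphism. -/
noncomputable def scaleHomeo [Nontrivial E] (g : RiemannianMetricOn I M) :
    ScaleBundle g ≃ₜ PosReal × M :=
  (scaleTriv g).toHomeomorphOfIsInducing ⟨rfl⟩

noncomputable instance [Nontrivial E] (g : RiemannianMetricOn I M) :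
    ChartedSpace (ModelProd ℝ H) (ScaleBundle g) where
  atlas := {e | ∃ f ∈ atlas (ModelProd ℝ H) (PosReal × M),
    e = (scaleHomeo g).toOpenPartialHomeomorph ≫ₕ f}
  chartAt q := (scaleHomeo g).toOpenPartialHomeomorph ≫ₕ chartAt (ModelProd ℝ H) (scaleHomeo g q)
  mem_chart_source q := by simp
  chart_mem_atlas q := ⟨_, chart_mem_atlas _ _, rfl⟩

instance [Nontrivial E] (g : RiemannianMetricOn I M) :
    IsManifold (𝓘(ℝ, ℝ).prod I) ∞ (ScaleBundle g) where
  compatible := by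
    rintro _ _ ⟨e, he, rfl⟩ ⟨f, hf, rfl⟩
    have h := HasGroupoid.compatible (G := contDiffGroupoid ∞ (𝓘(ℝ, ℝ).prod I)) he hf
    refine (contDiffGroupoid ∞ (𝓘(ℝ, ℝ).prod I)).mem_of_eqOnSource h ?_
    refine ⟨?_, ?_⟩
    · ext z; simp
    · intro z hz; simp

end Scale

/-! ### The ambient manifold and the ambient metric -/

section Ambient

/-- The open set `(0, ∞) × (-ε, ε)` of the plane, with coordinates `(t, ρ)`. -/
def Strip (ε : ℝ) : TopologicalSpace.Opens (ℝ × ℝ) :=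
  ⟨Ioi 0 ×ˢ Ioo (-ε) ε, isOpen_Ioi.prod isOpen_Ioo⟩

/-- The ambient manifold `(0, ∞) × (-ε, ε) × M`. -/
abbrev Ambient (ε : ℝ) (M : Type*) : Type _ := Strip ε × M

variable {E : Type*} [NormedAddCommGroup E] [NormedSpace ℝ E]
  {H : Type*} [TopologicalSpace H] (I : ModelWithCorners ℝ E H)
  {M : Type*} [TopologicalSpace M] [ChartedSpace H M]

/-- The model of the ambient manifold. -/
noncomputable abbrev ambientModel : ModelWithCorners ℝ ((ℝ × ℝ) × E) (ModelProd (ℝ × ℝ) H) :=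
  𝓘(ℝ, ℝ × ℝ).prod I

/-- The coordinate function `t` on the ambient manifold. -/
def tFun {ε : ℝ} (p : Ambient ε M) : ℝ := p.1.1.1

/-- The coordinate function `ρ` on the ambient manifold. -/
def rhoFun {ε : ℝ} (p : Ambient ε M) : ℝ := p.1.1.2

/-- The coordinate vector field `∂_t`; the chart of the open set `Strip ε` of `ℝ × ℝ` is the
inclusion, so that its tangent spaces are `ℝ × ℝ`. -/
noncomputable def partialT {ε : ℝ} (p : Ambient ε M) : TangentSpace (ambientModel I) p :=
  (((1, 0), 0) : (ℝ × ℝ) × E)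

/-- The coordinate vector field `∂_ρ`. -/
noncomputable def partialRho {ε : ℝ} (p : Ambient ε M) : TangentSpace (ambientModel I) p :=
  (((0, 1), 0) : (ℝ × ℝ) × E)

/-- The lift of a tangent vector of `M` to the ambient manifold. -/
noncomputable def lift {ε : ℝ} (p : Ambient ε M) (v : TangentSpace I p.2) : TangentSpace (ambientModel I) p :=
  (((0, 0), v) : (ℝ × ℝ) × E)

/-- The metric `d(ρt) ⊗ dt + dt ⊗ d(ρt) + t² g(α(ρ)·, ·)` on the ambient manifold. -/
noncomputable def ambientMetric (g : FormField I M)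
    (α : ℝ → ∀ x : M, TangentSpace I x →L[ℝ] TangentSpace I x) (ε : ℝ) :
    FormField (ambientModel I) (Ambient ε M) := fun p =>
  let dt : TangentSpace (ambientModel I) p →L[ℝ] ℝ := mfderiv (ambientModel I) 𝓘(ℝ, ℝ) tFun p
  let drt : TangentSpace (ambientModel I) p →L[ℝ] ℝ :=
    mfderiv (ambientModel I) 𝓘(ℝ, ℝ) (fun q : Ambient ε M => rhoFun q * tFun q) p
  let dπ : TangentSpace (ambientModel I) p →L[ℝ] TangentSpace I p.2 :=
    mfderiv (ambientModel I) I Prod.snd p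
  tensor drt dt + tensor dt drt + (tFun p ^ 2) • compForm (g p.2 ∘L α (rhoFun p) p.2) dπ dπ

/-- The immersion `Ψ^u : x ↦ (e^{u(x)}, 0, x)`. -/
noncomputable def immersion {ε : ℝ} (hε : 0 < ε) (u : M → ℝ) (x : M) : Ambient ε M :=
  (⟨(Real.exp (u x), 0), Real.exp_pos _, by simpa using hε, hε⟩, x)

/-- The lightlike normal vector field
`η^u = e^{-u} (|∇u|² / 2) ∂_t - e^{-2u} ∂_ρ + e^{-2u} ∇u` along `Ψ^u`. -/
noncomputable def eta (g : FormField I M) {ε : ℝ} (hε : 0 < ε) (u : M → ℝ) (x : M) :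
    TangentSpace (ambientModel I) (immersion hε u x) :=
  (Real.exp (-u x) * (g x (grad I g u x) (grad I g u x) / 2)) • partialT I (immersion hε u x)
    - Real.exp (-(2 * u x)) • partialRho I (immersion hε u x)
    + Real.exp (-(2 * u x)) • lift I (immersion hε u x) (grad I g u x)

variable {I}

/-- The embedding `t^2 g_x ↦ (t, 0, x)` of the scale bundle into the ambient manifold. -/
noncomputable def scaleEmbedding [IsManifold I ∞ M] [Nontrivial E] (g : RiemannianMetricOn I M)
    {ε : ℝ} (hε : 0 < ε) (q : ScaleBundle g) : Ambient ε M :=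
  (⟨((scaleTriv g q).1, 0), (scaleTriv g q).1.2, by simpa using hε, hε⟩, (scaleTriv g q).2)

end Ambient

instance (n : ℕ) [hn : Fact (3 ≤ n)] : Nontrivial (EuclideanSpace ℝ (Fin n)) :=
  have : Nonempty (Fin n) := ⟨⟨0, by have := hn.out; omega⟩⟩
  inferInstance

end ConformalAmbient

open ConformalAmbient

namespace ConformalAmbient

set_option maxSynthPendingDepth 3

/-! ### Linear algebra of nondegenerate forms and of traces -/

section LinearAlgebraLemmas

variable {E : Type*} [NormedAddCommGroup E] [NormedSpace ℝ E]

/-! Both claims are pointwise, and each tensor at a point is computed in the preferred chart there.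
The chart of the ambient manifold at `(t, ρ, x)` is the inclusion of the strip times the chart of
`M` at `x`. Hence both sides are read in the same chart, independence of the chart is never needed,
and everything reduces to an identity on a vector space `E` of dimension n ≥ 3, with metric G,
function f and a family γ(ρ) with γ(0) = G. There the ambient metric is 2ρ dt² + 2t dt dρ + t² γ(ρ)
(`coordMetric_ambientMetric`).

Schouten tensor. The conformal law P(e^{2f}G) = P − Hess f + df ⊗ df − (|df|²/2) G
(`coordSchouten_exp_smul`) comes from the Christoffel symbols of e^{2f}G by tracing the curvature
twice. On the other side, the explicit ambient Christoffel symbols (`christoffel_coordAmbient`) show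
that pairing the covariant derivative of η with tangent vectors of the immersion gives Hess f − df ⊗
df + (|df|²/2) G − γ'(0)/2 (`coordAmbient_covariantDeriv_coordEta`). If γ'(0) = 2P this is exactly
−P(e^{2f}G), and the immersion induces e^{2f}G, so the Weingarten endomorphism represents the
Schouten tensor.

Ricci tensor. For vectors tangent to ρ = 0, the trace of u ↦ R(u, X)Y receives nothing from the t-
and ρ-directions, and the `E`-block gives Ric − ((n−2)/2) γ'(0) − (1/2) tr γ'(0) · G
(`coordRicci_coordAmbient`). With γ'(0) = 2P this is Ric − (n−2)P − (tr P)G, which vanishes by the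
definition of P, since tr P = scal/(2(n−1)). Second ρ-derivatives of γ do not contribute. -/

theorem raise_apply {B : E →L[ℝ] E →L[ℝ] ℝ} (hB : B.IsInvertible) (S : E →L[ℝ] E →L[ℝ] ℝ)
    (v w : E) : B (raise B S v) w = S v w := by
  have h : B (raise B S v) = S v := by simp [raise, hB]
  rw [h]

theorem neg_raise_apply {B : E →L[ℝ] E →L[ℝ] ℝ} (hB : B.IsInvertible) (S : E →L[ℝ] E →L[ℝ] ℝ)
    (v w : E) : B ((-raise B S) v) w = -S v w := by
  rw [neg_apply, map_neg, neg_apply, raise_apply hB]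

theorem form_ext {B : E →L[ℝ] E →L[ℝ] ℝ} (hB : B.IsInvertible) {v v' : E}
    (h : ∀ w, B v w = B v' w) : v = v' :=
  hB.injective (ContinuousLinearMap.ext h)

theorem eq_raise {B S : E →L[ℝ] E →L[ℝ] ℝ} (hB : B.IsInvertible) {A : E →L[ℝ] E}
    (h : ∀ v w, B (A v) w = S v w) : A = raise B S :=
  ContinuousLinearMap.ext fun v => form_ext hB fun w => by rw [h, raise_apply hB]

theorem raise_add (B S S' : E →L[ℝ] E →L[ℝ] ℝ) : raise B (S + S') = raise B S + raise B S' := by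
  simp [raise]

theorem raise_sub (B S S' : E →L[ℝ] E →L[ℝ] ℝ) : raise B (S - S') = raise B S - raise B S' := by
  simp [raise]

theorem raise_smul (B S : E →L[ℝ] E →L[ℝ] ℝ) (c : ℝ) : raise B (c • S) = c • raise B S := by
  simp [raise]

theorem raise_self {B : E →L[ℝ] E →L[ℝ] ℝ} (hB : B.IsInvertible) :
    raise B B = ContinuousLinearMap.id ℝ E := by
  simp [raise, hB]

theorem smul_isInvertible {B : E →L[ℝ] E →L[ℝ] ℝ} (hB : B.IsInvertible) {c : ℝ} (hc : c ≠ 0) :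
    (c • B).IsInvertible := by
  obtain ⟨e, rfl⟩ := hB
  exact ⟨e.trans (ContinuousLinearEquiv.smulLeft (Units.mk0 c hc)), rfl⟩

theorem raise_smul_left {B : E →L[ℝ] E →L[ℝ] ℝ} (hB : B.IsInvertible) {c : ℝ} (hc : c ≠ 0)
    (S : E →L[ℝ] E →L[ℝ] ℝ) : raise (c • B) S = c⁻¹ • raise B S := by
  symm
  refine eq_raise (smul_isInvertible hB hc) fun v w => ?_
  simp [raise_apply hB, hc]

variable [FiniteDimensional ℝ E]

/-- In finite dimension an injective map from `E` to its dual is bijective. This supplies the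
invertibility without which `inverse`, and hence `raise` and `christoffel`, would take the default
value 0. -/
theorem isInvertible_of_nondegenerate {B : E →L[ℝ] E →L[ℝ] ℝ}
    (h : ∀ v, (∀ w, B v w = 0) → v = 0) : B.IsInvertible := by
  let e : E →ₗ[ℝ] Module.Dual ℝ E := (ContinuousLinearMap.coeLM ℝ) ∘ₗ (B : E →ₗ[ℝ] E →L[ℝ] ℝ)
  have he : Function.Injective B := by
    refine (injective_iff_map_eq_zero B).2 fun v hv => h v fun w => by rw [hv]; rfl
  have hd : Module.finrank ℝ E = Module.finrank ℝ (E →L[ℝ] ℝ) := by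
    rw [← (LinearMap.toContinuousLinearMap (𝕜 := ℝ) (E := E) (F' := ℝ)).finrank_eq]
    exact Subspace.dual_finrank_eq.symm
  exact ⟨(LinearEquiv.ofInjectiveOfFinrankEq (B : E →ₗ[ℝ] E →L[ℝ] ℝ) he hd).toContinuousLinearEquiv,
    ContinuousLinearMap.ext fun v => rfl⟩

theorem traceL_apply (A : E →L[ℝ] E) : traceL A = LinearMap.trace ℝ E A := rfl

theorem traceL_smulRight (φ : E →L[ℝ] ℝ) (z : E) : traceL (φ.smulRight z) = φ z :=
  LinearMap.trace_smulRight (φ : E →ₗ[ℝ] ℝ) z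

theorem traceL_id : traceL (ContinuousLinearMap.id ℝ E) = Module.finrank ℝ E :=
  LinearMap.trace_id ℝ E

theorem traceL_real (A : ℝ →L[ℝ] ℝ) : traceL A = A 1 := by
  have h : A = A.smulRight (1 : ℝ) := by ext; simp
  conv_lhs => rw [h]
  rw [traceL_smulRight]

/-- Split the target by the two projections and use cyclicity of the trace: only the diagonal blocks
contribute. -/
theorem traceL_prod {F : Type*} [NormedAddCommGroup F] [NormedSpace ℝ F] [FiniteDimensional ℝ F]
    (A : E × F →L[ℝ] E × F) :
    traceL A = traceL (ContinuousLinearMap.fst ℝ E F ∘L A ∘L ContinuousLinearMap.inl ℝ E F) +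
      traceL (ContinuousLinearMap.snd ℝ E F ∘L A ∘L ContinuousLinearMap.inr ℝ E F) := by
  have h : (A : E × F →ₗ[ℝ] E × F) =
      (LinearMap.inl ℝ E F) ∘ₗ (LinearMap.fst ℝ E F ∘ₗ (A : E × F →ₗ[ℝ] E × F)) +
      (LinearMap.inr ℝ E F) ∘ₗ (LinearMap.snd ℝ E F ∘ₗ (A : E × F →ₗ[ℝ] E × F)) := by
    ext <;> simp
  rw [traceL_apply, h, map_add, LinearMap.trace_comp_comm', LinearMap.trace_comp_comm' _ (LinearMap.inr ℝ E F)]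
  rfl

end LinearAlgebraLemmas

/-! ### Metrics near a point of a vector space -/

section CoordinateMetrics

variable {E : Type*} [NormedAddCommGroup E] [NormedSpace ℝ E]

/-- `G` is a twice continuously differentiable nondegenerate metric near `e`. -/
structure IsMetricAt (G : E → E →L[ℝ] E →L[ℝ] ℝ) (e : E) : Prop where
  contDiffAt : ContDiffAt ℝ 2 G e
  symm : ∀ᶠ y in 𝓝 e, ∀ v w, G y v w = G y w v
  inv : ∀ᶠ y in 𝓝 e, (G y).IsInvertible

variable {G : E → E →L[ℝ] E →L[ℝ] ℝ} {e : E}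

namespace IsMetricAt

theorem eventually (h : IsMetricAt G e) : ∀ᶠ y in 𝓝 e, IsMetricAt G y := by
  filter_upwards [h.contDiffAt.eventually (by simp), eventually_eventually_nhds.2 h.symm,
    eventually_eventually_nhds.2 h.inv] with y h1 h2 h3
  exact ⟨h1, h2, h3⟩

theorem isInvertible (h : IsMetricAt G e) : (G e).IsInvertible := h.inv.self_of_nhds

theorem symm_apply (h : IsMetricAt G e) (v w : E) : G e v w = G e w v := h.symm.self_of_nhds v w

theorem differentiableAt (h : IsMetricAt G e) : DifferentiableAt ℝ G e :=
  h.contDiffAt.differentiableAt (by simp)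

theorem hasFDerivAt_apply (h : IsMetricAt G e) (v w : E) :
    HasFDerivAt (fun y => G y v w) (((fderiv ℝ G e).flip v).flip w) e :=
  (h.differentiableAt.hasFDerivAt.clm_apply (hasFDerivAt_const v e)).clm_apply
    (hasFDerivAt_const w e) |>.congr_fderiv (ContinuousLinearMap.ext fun u => by simp)

theorem fderiv_symm (h : IsMetricAt G e) (u v w : E) :
    fderiv ℝ G e u v w = fderiv ℝ G e u w v := by
  have h1 := (h.hasFDerivAt_apply v w).congr_of_eventuallyEq
    (h.symm.mono fun y hy => hy w v)
  exact congrArg (fun φ => φ u) (h1.unique (h.hasFDerivAt_apply w v))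

/-- The Koszul formula determines the Christoffel symbols by nondegeneracy, so explicit formulas
only have to be verified by pairing, without inverting the metric. -/
theorem christoffel_eq (h : IsMetricAt G e) {v w X : E}
    (hX : ∀ z, G e X z = (1 / 2) *
      (fderiv ℝ G e v w z + fderiv ℝ G e w v z - fderiv ℝ G e z v w)) :
    christoffel G e v w = X :=
  form_ext h.isInvertible fun z => by rw [christoffel_apply G e v w z h.isInvertible, hX]

theorem christoffel_symm (h : IsMetricAt G e) (v w : E) :
    christoffel G e v w = christoffel G e w v :=
  h.christoffel_eq fun z => by
    rw [christoffel_apply G e w v z h.isInvertible, h.fderiv_symm z w v]; ring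

/-- Compatibility of the connection with the metric, from adding two Koszul formulas. It trades
derivatives of `G` for Christoffel symbols in the curvature computations. -/
theorem fderiv_eq (h : IsMetricAt G e) (u v w : E) :
    fderiv ℝ G e u v w = G e (christoffel G e u v) w + G e v (christoffel G e u w) := by
  rw [h.symm_apply v, christoffel_apply G e _ _ _ h.isInvertible,
    christoffel_apply G e _ _ _ h.isInvertible, h.fderiv_symm v u w, h.fderiv_symm w u v,
    h.fderiv_symm u v w]
  ring

theorem contDiffAt_inverse [CompleteSpace E] (h : IsMetricAt G e) :
    ContDiffAt ℝ 2 (fun y => (G y).inverse) e :=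
  (h.isInvertible.contDiffAt_map_inverse).comp e h.contDiffAt

theorem differentiableAt_koszul {D : E → E →L[ℝ] E →L[ℝ] E →L[ℝ] ℝ} (h : DifferentiableAt ℝ D e) :
    DifferentiableAt ℝ (fun y => koszul (D y)) e := by
  have h1 : DifferentiableAt ℝ (fun y => flipL E (E →L[ℝ] ℝ) (D y)) e :=
    (flipL E (E →L[ℝ] ℝ)).differentiableAt.comp e h
  have h2 : DifferentiableAt ℝ (fun y => flipL E ℝ ∘L flipL E (E →L[ℝ] ℝ) (D y)) e :=
    (differentiableAt_const _).clm_comp h1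
  exact ((h.add h1).sub h2).const_smul (1 / 2 : ℝ)

theorem differentiableAt_christoffel [CompleteSpace E] (h : IsMetricAt G e) :
    DifferentiableAt ℝ (christoffel G) e := by
  have h1 : DifferentiableAt ℝ (fderiv ℝ G) e :=
    (h.contDiffAt.fderiv_right (m := 1) (by norm_num)).differentiableAt (by simp)
  have h2 : DifferentiableAt ℝ (fun y => (G y).inverse) e :=
    h.contDiffAt_inverse.differentiableAt (by simp)
  exact ((ContinuousLinearMap.compL ℝ E (E →L[ℝ] ℝ) E).differentiableAt.comp e h2).clm_comp
    (differentiableAt_koszul h1)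

theorem hasFDerivAt_christoffel [CompleteSpace E] (h : IsMetricAt G e) (v w : E) :
    HasFDerivAt (fun y => christoffel G y v w) (((fderiv ℝ (christoffel G) e).flip v).flip w) e :=
  (h.differentiableAt_christoffel.hasFDerivAt.clm_apply (hasFDerivAt_const v e)).clm_apply
    (hasFDerivAt_const w e) |>.congr_fderiv (ContinuousLinearMap.ext fun u => by simp)

end IsMetricAt

theorem christoffel_congr {G' : E → E →L[ℝ] E →L[ℝ] ℝ} (hG : G' =ᶠ[𝓝 e] G) :
    christoffel G' =ᶠ[𝓝 e] christoffel G := by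
  filter_upwards [hG.eventuallyEq_nhds] with y hy
  simp only [christoffel, hy.self_of_nhds, hy.fderiv_eq]

theorem coordCurvature_congr {G' : E → E →L[ℝ] E →L[ℝ] ℝ} (hG : G' =ᶠ[𝓝 e] G) :
    coordCurvature G' e = coordCurvature G e := by
  simp only [coordCurvature, (christoffel_congr hG).self_of_nhds, (christoffel_congr hG).fderiv_eq]

theorem coordRicci_congr [FiniteDimensional ℝ E] {G' : E → E →L[ℝ] E →L[ℝ] ℝ}
    (hG : G' =ᶠ[𝓝 e] G) : coordRicci G' e = coordRicci G e := by
  simp only [coordRicci, coordCurvature_congr hG]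

theorem coordRicci_eq_traceL [FiniteDimensional ℝ E] (G : E → E →L[ℝ] E →L[ℝ] ℝ) (e v w : E) :
    coordRicci G e v w = traceL (((coordCurvature G e).flip v).flip w) := rfl

end CoordinateMetrics

/-! ### Conformal change of a metric on a vector space -/

section CoordinateConformal

variable {E : Type*} [NormedAddCommGroup E] [NormedSpace ℝ E]
  {G : E → E →L[ℝ] E →L[ℝ] ℝ} {e : E} {f : E → ℝ}

/-- The gradient of `f` with respect to `G`. -/
noncomputable def coordGrad (G : E → E →L[ℝ] E →L[ℝ] ℝ) (f : E → ℝ) (e : E) : E :=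
  (G e).inverse (fderiv ℝ f e)

/-- The Hessian `(v, w) ↦ D²f(v, w) - Df(Γ(v, w))` of `f` with respect to `G`. -/
noncomputable def coordHessian (G : E → E →L[ℝ] E →L[ℝ] ℝ) (f : E → ℝ) (e : E) :
    E →L[ℝ] E →L[ℝ] ℝ :=
  fderiv ℝ (fderiv ℝ f) e - ContinuousLinearMap.compL ℝ E E ℝ (fderiv ℝ f e) ∘L christoffel G e

theorem coordHessian_apply (v w : E) :
    coordHessian G f e v w =
      fderiv ℝ (fderiv ℝ f) e v w - fderiv ℝ f e (christoffel G e v w) := rfl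

theorem coordGrad_spec (h : (G e).IsInvertible) (v : E) :
    G e (coordGrad G f e) v = fderiv ℝ f e v := by
  simp [coordGrad, h]

theorem hasFDerivAt_fderiv_apply (hf : ContDiffAt ℝ 2 f e) (v : E) :
    HasFDerivAt (fun y => fderiv ℝ f y v) ((fderiv ℝ (fderiv ℝ f) e).flip v) e := by
  have h1 : DifferentiableAt ℝ (fderiv ℝ f) e :=
    (hf.fderiv_right (m := 1) (by norm_num)).differentiableAt (by simp)
  exact (h1.hasFDerivAt.clm_apply (hasFDerivAt_const v e)).congr_fderiv
    (ContinuousLinearMap.ext fun u => by simp)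

theorem fderiv_fderiv_symm (hf : ContDiffAt ℝ 2 f e) (v w : E) :
    fderiv ℝ (fderiv ℝ f) e v w = fderiv ℝ (fderiv ℝ f) e w v :=
  hf.isSymmSndFDerivAt (by simp) v w

theorem differentiableAt_coordGrad [CompleteSpace E] (h : IsMetricAt G e)
    (hf : ContDiffAt ℝ 2 f e) : DifferentiableAt ℝ (coordGrad G f) e :=
  (h.contDiffAt_inverse.differentiableAt (by simp)).clm_apply
    ((hf.fderiv_right (m := 1) (by norm_num)).differentiableAt (by simp))

/-- The covariant derivative of the gradient is the Hessian. -/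
theorem covariantDeriv_coordGrad [CompleteSpace E] (h : IsMetricAt G e)
    (hf : ContDiffAt ℝ 2 f e) (v w : E) :
    G e (fderiv ℝ (coordGrad G f) e v + christoffel G e v (coordGrad G f e)) w =
      coordHessian G f e v w := by
  -- Differentiate G(∇f, w) = df(w), valid near `e`, in two ways; metric compatibility turns the
  -- derivative of `G` into Christoffel terms.
  have h1 : HasFDerivAt (fun y => G y (coordGrad G f y) w) _ e :=
    (h.differentiableAt.hasFDerivAt.clm_apply
      (differentiableAt_coordGrad h hf).hasFDerivAt).clm_apply (hasFDerivAt_const w e)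
  have h2 := h1.unique ((hasFDerivAt_fderiv_apply hf w).congr_of_eventuallyEq
    (h.inv.mono fun y hy => coordGrad_spec hy w))
  have h3 := congrArg (fun φ => φ v) h2
  simp only [ContinuousLinearMap.comp_zero, zero_add, add_apply,
    ContinuousLinearMap.comp_apply, ContinuousLinearMap.flip_apply, h.fderiv_eq] at h3
  have h4 := coordGrad_spec (f := f) h.isInvertible (christoffel G e v w)
  rw [coordHessian_apply, ← h3, map_add, add_apply]
  linarith

theorem exp_smul_isMetricAt (h : IsMetricAt G e) (hf : ContDiffAt ℝ 2 f e) :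
    IsMetricAt (fun y => Real.exp (2 * f y) • G y) e := by
  refine ⟨?_, ?_, ?_⟩
  · exact (Real.contDiff_exp.contDiffAt.comp e (contDiffAt_const.mul hf)).smul h.contDiffAt
  · filter_upwards [h.symm] with y hy v w
    simp [hy v w]
  · filter_upwards [h.inv] with y hy using smul_isInvertible hy (Real.exp_ne_zero _)

theorem fderiv_exp_smul (h : IsMetricAt G e) (hf : ContDiffAt ℝ 2 f e) (u v w : E) :
    fderiv ℝ (fun y => Real.exp (2 * f y) • G y) e u v w =
      Real.exp (2 * f e) * (2 * fderiv ℝ f e u * G e v w + fderiv ℝ G e u v w) := by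
  have h1 := ((hf.differentiableAt (by simp)).hasFDerivAt.const_mul 2).exp.smul
    h.differentiableAt.hasFDerivAt
  rw [show (fun y => Real.exp (2 * f y) • G y) = (fun y => Real.exp (2 * f y)) • G from rfl,
    h1.fderiv]
  simp
  ring

/-- In the Koszul formula the derivative of the factor e^{2f} adds one term for each of the three
slots, and the common factor cancels. -/
theorem christoffel_exp_smul (h : IsMetricAt G e) (hf : ContDiffAt ℝ 2 f e) (v w : E) :
    christoffel (fun y => Real.exp (2 * f y) • G y) e v w =
      christoffel G e v w + fderiv ℝ f e v • w + fderiv ℝ f e w • v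
        - G e v w • coordGrad G f e := by
  refine (exp_smul_isMetricAt h hf).christoffel_eq fun z => ?_
  simp only [fderiv_exp_smul h hf, smul_apply, smul_eq_mul, map_sub, map_add, map_smul,
    sub_apply, add_apply, christoffel_apply G e v w z h.isInvertible,
    coordGrad_spec h.isInvertible]
  ring

/-- The covariant derivative of the gradient of `f`. -/
noncomputable def coordNablaGrad (G : E → E →L[ℝ] E →L[ℝ] ℝ) (f : E → ℝ) (e : E) : E →L[ℝ] E :=
  fderiv ℝ (coordGrad G f) e + (christoffel G e).flip (coordGrad G f e)

theorem coordCurvature_exp_smul [CompleteSpace E] (h : IsMetricAt G e) (hf : ContDiffAt ℝ 2 f e)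
    (u v w : E) :
    coordCurvature (fun y => Real.exp (2 * f y) • G y) e u v w =
      coordCurvature G e u v w
        + coordHessian G f e u w • v - coordHessian G f e v w • u
        - G e v w • coordNablaGrad G f e u + G e u w • coordNablaGrad G f e v
        + (fderiv ℝ f e v * fderiv ℝ f e w) • u - (fderiv ℝ f e u * fderiv ℝ f e w) • v
        - (fderiv ℝ f e (coordGrad G f e) * G e v w) • u
        + (fderiv ℝ f e (coordGrad G f e) * G e u w) • v
        + (fderiv ℝ f e u * G e v w - fderiv ℝ f e v * G e u w) • coordGrad G f e := by
  -- The formula for the conformal Christoffel symbols holds on a neighbourhood of `e`, so it can be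
  -- differentiated. The term D²f(u, v) w is symmetric in u, v and drops out of the curvature.
  have key : ∀ u v w : E, fderiv ℝ (christoffel fun y => Real.exp (2 * f y) • G y) e u v w =
      fderiv ℝ (christoffel G) e u v w + fderiv ℝ (fderiv ℝ f) e u v • w
        + fderiv ℝ (fderiv ℝ f) e u w • v
        - (G e v w • fderiv ℝ (coordGrad G f) e u + fderiv ℝ G e u v w • coordGrad G f e) := by
    intro u v w
    have h1 := (((h.hasFDerivAt_christoffel v w).add
      ((hasFDerivAt_fderiv_apply hf v).smul_const w)).add
      ((hasFDerivAt_fderiv_apply hf w).smul_const v)).sub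
      ((h.hasFDerivAt_apply v w).smul (differentiableAt_coordGrad h hf).hasFDerivAt)
    have h2 := h1.congr_of_eventuallyEq (f₁ := fun y =>
      christoffel (fun y => Real.exp (2 * f y) • G y) y v w) (by
        filter_upwards [h.eventually, hf.eventually (by simp)] with y hy hfy
        rw [christoffel_exp_smul hy hfy]; rfl)
    have h3 := congrArg (fun φ => φ u)
      (((exp_smul_isMetricAt h hf).hasFDerivAt_christoffel v w).unique h2)
    simpa using h3
  have hZ := coordGrad_spec (f := f) h.isInvertible
  simp only [coordCurvature_apply, key, christoffel_exp_smul h hf, coordHessian_apply, h.fderiv_eq,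
    coordNablaGrad, map_add, map_sub, map_smul, add_apply, smul_eq_mul,
    ContinuousLinearMap.flip_apply]
  rw [fderiv_fderiv_symm hf v u, h.christoffel_symm v u,
    h.symm_apply v u, h.symm_apply u (coordGrad G f e), h.symm_apply v (coordGrad G f e), hZ, hZ]
  module

theorem coordNablaGrad_eq_raise [CompleteSpace E] (h : IsMetricAt G e) (hf : ContDiffAt ℝ 2 f e) :
    coordNablaGrad G f e = raise (G e) (coordHessian G f e) :=
  eq_raise h.isInvertible fun v w => covariantDeriv_coordGrad h hf v w

theorem raise_tensor (h : (G e).IsInvertible) :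
    raise (G e) (tensor (fderiv ℝ f e) (fderiv ℝ f e)) =
      (fderiv ℝ f e).smulRight (coordGrad G f e) := by
  symm
  refine eq_raise h fun v w => ?_
  simp [tensor_apply, coordGrad_spec h]

variable [FiniteDimensional ℝ E]

theorem coordRicci_exp_smul (h : IsMetricAt G e) (hf : ContDiffAt ℝ 2 f e) :
    coordRicci (fun y => Real.exp (2 * f y) • G y) e =
      coordRicci G e + ((Module.finrank ℝ E : ℝ) - 2) •
          (tensor (fderiv ℝ f e) (fderiv ℝ f e) - coordHessian G f e)
        - (traceL (raise (G e) (coordHessian G f e)) +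
            ((Module.finrank ℝ E : ℝ) - 2) * fderiv ℝ f e (coordGrad G f e)) • G e := by
  have : CompleteSpace E := FiniteDimensional.complete ℝ E
  ext v w
  -- As an endomorphism in u, the curvature correction consists of multiples of the identity, of the
  -- raised Hessian, and of rank-one maps, whose traces are immediate.
  have key : ((coordCurvature (fun y => Real.exp (2 * f y) • G y) e).flip v).flip w =
      ((coordCurvature G e).flip v).flip w
        + ((coordHessian G f e).flip w).smulRight v
        - coordHessian G f e v w • ContinuousLinearMap.id ℝ E
        - G e v w • raise (G e) (coordHessian G f e)
        + ((G e).flip w).smulRight (raise (G e) (coordHessian G f e) v)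
        + (fderiv ℝ f e v * fderiv ℝ f e w) • ContinuousLinearMap.id ℝ E
        - fderiv ℝ f e w • (fderiv ℝ f e).smulRight v
        - (fderiv ℝ f e (coordGrad G f e) * G e v w) • ContinuousLinearMap.id ℝ E
        + fderiv ℝ f e (coordGrad G f e) • ((G e).flip w).smulRight v
        + G e v w • (fderiv ℝ f e).smulRight (coordGrad G f e)
        - fderiv ℝ f e v • ((G e).flip w).smulRight (coordGrad G f e) := by
    refine ContinuousLinearMap.ext fun u => ?_
    rw [← coordNablaGrad_eq_raise h hf]
    simp only [ContinuousLinearMap.flip_apply, coordCurvature_exp_smul h hf, add_apply, sub_apply,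
      smul_apply, ContinuousLinearMap.smulRight_apply, ContinuousLinearMap.id_apply]
    module
  rw [coordRicci_eq_traceL, key]
  simp only [map_add, map_sub, map_smul, traceL_id, traceL_smulRight, smul_eq_mul, add_apply,
    sub_apply, smul_apply, tensor_apply, coordRicci_eq_traceL, ContinuousLinearMap.flip_apply,
    raise_apply h.isInvertible, coordGrad_spec h.isInvertible]
  ring

/-- The scalar curvature of `G`. -/
noncomputable def coordScalar (G : E → E →L[ℝ] E →L[ℝ] ℝ) (e : E) : ℝ :=
  traceL (raise (G e) (coordRicci G e))

/-- The Schouten tensor of `G`. -/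
noncomputable def coordSchouten (G : E → E →L[ℝ] E →L[ℝ] ℝ) (e : E) : E →L[ℝ] E →L[ℝ] ℝ :=
  (1 / ((Module.finrank ℝ E : ℝ) - 2)) •
    (coordRicci G e - (coordScalar G e / (2 * ((Module.finrank ℝ E : ℝ) - 1))) • G e)

theorem coordScalar_exp_smul (h : IsMetricAt G e) (hf : ContDiffAt ℝ 2 f e) :
    coordScalar (fun y => Real.exp (2 * f y) • G y) e = (Real.exp (2 * f e))⁻¹ *
      (coordScalar G e - 2 * ((Module.finrank ℝ E : ℝ) - 1) *
          traceL (raise (G e) (coordHessian G f e))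
        - ((Module.finrank ℝ E : ℝ) - 2) * ((Module.finrank ℝ E : ℝ) - 1) *
          fderiv ℝ f e (coordGrad G f e)) := by
  rw [coordScalar, raise_smul_left h.isInvertible (Real.exp_ne_zero _), coordRicci_exp_smul h hf,
    coordScalar]
  simp only [raise_add, raise_sub, raise_smul, raise_self h.isInvertible,
    raise_tensor h.isInvertible, map_add, map_sub, map_smul, traceL_id, traceL_smulRight,
    smul_eq_mul]
  ring

/-- The conformal transformation law of the Schouten tensor. -/
theorem coordSchouten_exp_smul (hn : 3 ≤ Module.finrank ℝ E) (h : IsMetricAt G e)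
    (hf : ContDiffAt ℝ 2 f e) (v w : E) :
    coordSchouten (fun y => Real.exp (2 * f y) • G y) e v w =
      coordSchouten G e v w - coordHessian G f e v w + fderiv ℝ f e v * fderiv ℝ f e w
        - fderiv ℝ f e (coordGrad G f e) / 2 * G e v w := by
  have hn' : (3 : ℝ) ≤ Module.finrank ℝ E := by exact_mod_cast hn
  have h1 : (Module.finrank ℝ E : ℝ) - 2 ≠ 0 := by linarith
  have h2 : (Module.finrank ℝ E : ℝ) - 1 ≠ 0 := by linarith
  -- The Laplacian of `f` cancels between the Ricci and scalar terms, e^{2f} cancels its inverse,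
  -- and the coefficient of |df|² G becomes −1 + 1/2.
  simp only [coordSchouten, coordScalar_exp_smul h hf, coordRicci_exp_smul h hf, add_apply,
    sub_apply, smul_apply, smul_eq_mul, tensor_apply]
  field_simp
  ring

/-- A metric with first derivative `2 P` annihilates the Ricci tensor of its ambient metric. -/
theorem coordRicci_sub_coordSchouten (hn : 3 ≤ Module.finrank ℝ E) (h : (G e).IsInvertible) :
    coordRicci G e - ((Module.finrank ℝ E : ℝ) - 2) • coordSchouten G e
      - traceL (raise (G e) (coordSchouten G e)) • G e = 0 := by
  have hn' : (3 : ℝ) ≤ Module.finrank ℝ E := by exact_mod_cast hn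
  have h1 : (Module.finrank ℝ E : ℝ) - 2 ≠ 0 := by linarith
  have h2 : (Module.finrank ℝ E : ℝ) - 1 ≠ 0 := by linarith
  have h3 : traceL (raise (G e) (coordSchouten G e)) =
      coordScalar G e / (2 * ((Module.finrank ℝ E : ℝ) - 1)) := by
    rw [coordSchouten, raise_smul, raise_sub, raise_smul, raise_self h, map_smul, map_sub,
      map_smul, traceL_id, ← coordScalar, smul_eq_mul, smul_eq_mul]
    field_simp
    ring
  rw [h3, coordSchouten, smul_smul, mul_one_div_cancel h1]
  module

end CoordinateConformal

/-! ### The ambient metric of a family of metrics on a vector space -/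

section CoordinateAmbient

variable {E : Type*} [NormedAddCommGroup E] [NormedSpace ℝ E]

/-- `γ` is a twice continuously differentiable family of nondegenerate metrics near `q`. -/
structure IsMetricFamilyAt (γ : ℝ × E → E →L[ℝ] E →L[ℝ] ℝ) (q : ℝ × E) : Prop where
  contDiffAt : ContDiffAt ℝ 2 γ q
  symm : ∀ᶠ y in 𝓝 q, ∀ v w, γ y v w = γ y w v
  inv : ∀ᶠ y in 𝓝 q, (γ y).IsInvertible

/-- The derivative of the family `γ` with respect to the parameter. -/
noncomputable def paramDeriv (γ : ℝ × E → E →L[ℝ] E →L[ℝ] ℝ) (q : ℝ × E) : E →L[ℝ] E →L[ℝ] ℝ :=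
  fderiv ℝ γ q (1, 0)

variable {γ : ℝ × E → E →L[ℝ] E →L[ℝ] ℝ} {q : ℝ × E}

namespace IsMetricFamilyAt

theorem eventually (h : IsMetricFamilyAt γ q) : ∀ᶠ y in 𝓝 q, IsMetricFamilyAt γ y := by
  filter_upwards [h.contDiffAt.eventually (by simp), eventually_eventually_nhds.2 h.symm,
    eventually_eventually_nhds.2 h.inv] with y h1 h2 h3
  exact ⟨h1, h2, h3⟩

theorem differentiableAt (h : IsMetricFamilyAt γ q) : DifferentiableAt ℝ γ q :=
  h.contDiffAt.differentiableAt (by simp)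

theorem isInvertible (h : IsMetricFamilyAt γ q) : (γ q).IsInvertible := h.inv.self_of_nhds

theorem symm_apply (h : IsMetricFamilyAt γ q) (v w : E) : γ q v w = γ q w v :=
  h.symm.self_of_nhds v w

theorem isMetricAt {ρ : ℝ} {e : E} (h : IsMetricFamilyAt γ (ρ, e)) :
    IsMetricAt (fun y => γ (ρ, y)) e := by
  have hc : ContinuousAt (fun y : E => (ρ, y)) e := by fun_prop
  exact ⟨h.contDiffAt.comp e (contDiffAt_const.prodMk contDiffAt_id), hc.eventually h.symm,
    hc.eventually h.inv⟩

theorem fderiv_apply_symm (h : IsMetricFamilyAt γ q) (u : ℝ × E) (v w : E) :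
    fderiv ℝ γ q u v w = fderiv ℝ γ q u w v := by
  have key : ∀ v w : E, HasFDerivAt (fun y => γ y v w) (((fderiv ℝ γ q).flip v).flip w) q :=
    fun v w => ((h.differentiableAt.hasFDerivAt.clm_apply (hasFDerivAt_const v q)).clm_apply
      (hasFDerivAt_const w q)).congr_fderiv (ContinuousLinearMap.ext fun u => by simp)
  have h1 := (key v w).congr_of_eventuallyEq (h.symm.mono fun y hy => hy w v)
  exact congrArg (fun φ => φ u) (h1.unique (key w v))

theorem fderiv_slice {ρ : ℝ} {e : E} (h : IsMetricFamilyAt γ (ρ, e)) (u : E) :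
    fderiv ℝ (fun y => γ (ρ, y)) e u = fderiv ℝ γ (ρ, e) (0, u) := by
  have h1 : HasFDerivAt (fun y : E => γ (ρ, y)) _ e :=
    h.differentiableAt.hasFDerivAt.comp e ((hasFDerivAt_const ρ e).prodMk (hasFDerivAt_id e))
  rw [h1.fderiv]; simp

theorem fderiv_pair (s : ℝ) (u : E) :
    fderiv ℝ γ q (s, u) = s • paramDeriv γ q + fderiv ℝ γ q (0, u) := by
  rw [paramDeriv, ← map_smul, ← map_add]; simp

theorem hasDerivAt_param {ρ : ℝ} {e : E} (h : IsMetricFamilyAt γ (ρ, e)) (v w : E) :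
    HasDerivAt (fun s => γ (s, e) v w) (paramDeriv γ (ρ, e) v w) ρ := by
  have h1 : HasDerivAt (fun s => γ (s, e)) (paramDeriv γ (ρ, e)) ρ :=
    h.differentiableAt.hasFDerivAt.comp_hasDerivAt ρ
      ((hasDerivAt_id ρ).prodMk (hasDerivAt_const ρ e))
  have h2 := (h1.clm_apply (hasDerivAt_const ρ v)).clm_apply (hasDerivAt_const ρ w)
  simpa using h2

end IsMetricFamilyAt

variable (E) in
/-- The covector `dt`. -/
noncomputable def coordDT : (ℝ × ℝ) × E →L[ℝ] ℝ :=
  ContinuousLinearMap.fst ℝ ℝ ℝ ∘L ContinuousLinearMap.fst ℝ (ℝ × ℝ) E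

variable (E) in
/-- The covector `dρ`. -/
noncomputable def coordDRho : (ℝ × ℝ) × E →L[ℝ] ℝ :=
  ContinuousLinearMap.snd ℝ ℝ ℝ ∘L ContinuousLinearMap.fst ℝ (ℝ × ℝ) E

/-- The metric `d(ρt) ⊗ dt + dt ⊗ d(ρt) + t² γ`. -/
noncomputable def coordAmbient (γ : ℝ × E → E →L[ℝ] E →L[ℝ] ℝ) (p : (ℝ × ℝ) × E) :
    (ℝ × ℝ) × E →L[ℝ] (ℝ × ℝ) × E →L[ℝ] ℝ :=
  tensor (p.1.2 • coordDT E + p.1.1 • coordDRho E) (coordDT E) +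
    tensor (coordDT E) (p.1.2 • coordDT E + p.1.1 • coordDRho E) +
    (p.1.1 ^ 2) • compForm (γ (p.1.2, p.2)) (ContinuousLinearMap.snd ℝ (ℝ × ℝ) E)
      (ContinuousLinearMap.snd ℝ (ℝ × ℝ) E)

theorem coordAmbient_apply (γ : ℝ × E → E →L[ℝ] E →L[ℝ] ℝ) (p X Y : (ℝ × ℝ) × E) :
    coordAmbient γ p X Y = 2 * p.1.2 * X.1.1 * Y.1.1 + p.1.1 * (X.1.1 * Y.1.2 + X.1.2 * Y.1.1)
      + p.1.1 ^ 2 * γ (p.1.2, p.2) X.2 Y.2 := by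
  simp [coordAmbient, tensor_apply, compForm_apply, coordDT, coordDRho]
  ring

theorem coordAmbient_isInvertible [FiniteDimensional ℝ E] {p : (ℝ × ℝ) × E} (hp : p.1.1 ≠ 0)
    (h : (γ (p.1.2, p.2)).IsInvertible) : (coordAmbient γ p).IsInvertible := by
  refine isInvertible_of_nondegenerate fun X hX => ?_
  -- ∂_ρ is null and pairs only with ∂_t, so it isolates the t-component of `X`; then ∂_t isolates
  -- the ρ-component.
  have h1 := hX ((0, 1), 0)
  have h2 := hX ((1, 0), 0)
  simp only [coordAmbient_apply, map_zero, mul_zero, mul_one, zero_add, add_zero] at h1 h2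
  have h3 : X.1.1 = 0 := by simpa [hp] using h1
  have h4 : X.1.2 = 0 := by simpa [hp, h3] using h2
  have h5 : X.2 = 0 := form_ext h fun w => by
    have := hX ((0, 0), w)
    simpa [coordAmbient_apply, hp] using this
  exact Prod.ext (Prod.ext h3 h4) h5

theorem coordAmbient_isMetricAt [FiniteDimensional ℝ E] {p : (ℝ × ℝ) × E} (hp : p.1.1 ≠ 0)
    (h : IsMetricFamilyAt γ (p.1.2, p.2)) : IsMetricAt (coordAmbient γ) p := by
  have hc : ContinuousAt (fun y : (ℝ × ℝ) × E => (y.1.2, y.2)) p := by fun_prop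
  have hp' : ∀ᶠ y : (ℝ × ℝ) × E in 𝓝 p, y.1.1 ≠ 0 :=
    ContinuousAt.eventually_ne (by fun_prop) hp
  have h1 : ContDiffAt ℝ 2 (fun y : (ℝ × ℝ) × E => y.1.2 • coordDT E + y.1.1 • coordDRho E) p :=
    (contDiff_fst.snd.contDiffAt.smul contDiffAt_const).add
      (contDiff_fst.fst.contDiffAt.smul contDiffAt_const)
  have h2 : ContDiffAt ℝ 2 (fun y : (ℝ × ℝ) × E => γ (y.1.2, y.2)) p :=
    h.contDiffAt.comp p (contDiff_fst.snd.prodMk contDiff_snd).contDiffAt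
  refine ⟨?_, ?_, ?_⟩
  · exact ((h1.smulRight contDiffAt_const).add (contDiffAt_const.smulRight h1)).add
      ((contDiff_fst.fst.pow 2).contDiffAt.smul
        ((contDiffAt_const.clm_comp h2).clm_comp contDiffAt_const))
  · filter_upwards [hc.eventually h.symm] with y hy X Y
    rw [coordAmbient_apply, coordAmbient_apply, hy]; ring
  · filter_upwards [hc.eventually h.inv, hp'] with y hy hy' using coordAmbient_isInvertible hy' hy

theorem fderiv_coordAmbient {p : (ℝ × ℝ) × E} [FiniteDimensional ℝ E] (hp : p.1.1 ≠ 0)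
    (h : IsMetricFamilyAt γ (p.1.2, p.2)) (U X Y : (ℝ × ℝ) × E) :
    fderiv ℝ (coordAmbient γ) p U X Y =
      2 * U.1.2 * X.1.1 * Y.1.1 + U.1.1 * (X.1.1 * Y.1.2 + X.1.2 * Y.1.1)
      + 2 * p.1.1 * U.1.1 * γ (p.1.2, p.2) X.2 Y.2
      + p.1.1 ^ 2 * (U.1.2 * paramDeriv γ (p.1.2, p.2) X.2 Y.2
        + fderiv ℝ (fun y => γ (p.1.2, y)) p.2 U.2 X.2 Y.2) := by
  have ht : HasFDerivAt (fun y : (ℝ × ℝ) × E => y.1.1) (coordDT E) p := (coordDT E).hasFDerivAt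
  have hr : HasFDerivAt (fun y : (ℝ × ℝ) × E => y.1.2) (coordDRho E) p :=
    (coordDRho E).hasFDerivAt
  have hγ : HasFDerivAt (fun y : (ℝ × ℝ) × E => γ (y.1.2, y.2)) _ p :=
    h.differentiableAt.hasFDerivAt.comp p (hr.prodMk hasFDerivAt_snd)
  have hγ' := (hγ.clm_apply (hasFDerivAt_const X.2 p)).clm_apply (hasFDerivAt_const Y.2 p)
  have h1 := (((hr.const_mul 2).mul_const X.1.1).mul_const Y.1.1).add
    (ht.mul_const (X.1.1 * Y.1.2 + X.1.2 * Y.1.1)) |>.add ((ht.pow 2).mul hγ')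
  have h2 := (coordAmbient_isMetricAt hp h).hasFDerivAt_apply X Y
  have h3 := congrArg (fun φ => φ U) (h2.unique (h1.congr_of_eventuallyEq
    (Filter.Eventually.of_forall fun y => coordAmbient_apply γ y X Y)))
  simp only [ContinuousLinearMap.flip_apply] at h3
  rw [h3, h.fderiv_slice]
  simp [coordDT, coordDRho, IsMetricFamilyAt.fderiv_pair U.1.2 U.2]
  ring

/-- Checked against the Koszul formula. It is needed at ρ ≠ 0 too, because it is differentiated in ρ
at ρ = 0 to obtain the curvature. -/
theorem christoffel_coordAmbient [FiniteDimensional ℝ E] {p : (ℝ × ℝ) × E} (hp : p.1.1 ≠ 0)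
    (h : IsMetricFamilyAt γ (p.1.2, p.2)) (X Y : (ℝ × ℝ) × E) :
    christoffel (coordAmbient γ) p X Y =
      ((-(p.1.1 / 2) * paramDeriv γ (p.1.2, p.2) X.2 Y.2,
        (X.1.1 * Y.1.2 + X.1.2 * Y.1.1) / p.1.1 - γ (p.1.2, p.2) X.2 Y.2
          + p.1.2 * paramDeriv γ (p.1.2, p.2) X.2 Y.2),
        p.1.1⁻¹ • (X.1.1 • Y.2 + Y.1.1 • X.2) + christoffel (fun y => γ (p.1.2, y)) p.2 X.2 Y.2
          + (1 / 2 : ℝ) • (X.1.2 • raise (γ (p.1.2, p.2)) (paramDeriv γ (p.1.2, p.2)) Y.2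
            + Y.1.2 • raise (γ (p.1.2, p.2)) (paramDeriv γ (p.1.2, p.2)) X.2)) := by
  refine (coordAmbient_isMetricAt hp h).christoffel_eq fun Z => ?_
  have h1 := christoffel_apply (fun y => γ (p.1.2, y)) p.2 X.2 Y.2 Z.2 h.isInvertible
  simp only [fderiv_coordAmbient hp h, coordAmbient_apply, map_add, map_smul, add_apply, smul_apply,
    smul_eq_mul, raise_apply h.isInvertible, h1]
  field_simp
  ring

theorem IsMetricAt.hasDerivAt_christoffel_line [CompleteSpace E] {G : E → E →L[ℝ] E →L[ℝ] ℝ} {e : E}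
    (h : IsMetricAt G e) (u v w : E) :
    HasDerivAt (fun s : ℝ => christoffel G (e + s • u) v w)
      (fderiv ℝ (christoffel G) e u v w) 0 :=
  (h.hasFDerivAt_christoffel v w).hasLineDerivAt u

/-! ### Curvature of the ambient metric along ρ = 0. -/

section Ricci

variable {t : ℝ} {e : E}

theorem eventually_line (ht : t ≠ 0) (h : IsMetricFamilyAt γ (0, e)) (U : (ℝ × ℝ) × E) :
    ∀ᶠ s : ℝ in 𝓝 0, t + s * U.1.1 ≠ 0 ∧ IsMetricFamilyAt γ (s * U.1.2, e + s • U.2) := by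
  have h1 : ContinuousAt (fun s : ℝ => t + s * U.1.1) 0 := by fun_prop
  have h2 : ContinuousAt (fun s : ℝ => (s * U.1.2, e + s • U.2)) 0 := by fun_prop
  refine (h1.eventually_ne (by simpa using ht)).and (h2.eventually ?_)
  simpa using h.eventually

theorem hasDerivAt_fst_fst {c : ℝ → (ℝ × ℝ) × E} {c' : (ℝ × ℝ) × E} {x : ℝ}
    (hc : HasDerivAt c c' x) : HasDerivAt (fun s => (c s).1.1) c'.1.1 x :=
  (coordDT E).hasFDerivAt.comp_hasDerivAt x hc

theorem hasDerivAt_fst_snd {c : ℝ → (ℝ × ℝ) × E} {c' : (ℝ × ℝ) × E} {x : ℝ}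
    (hc : HasDerivAt c c' x) : HasDerivAt (fun s => (c s).1.2) c'.1.2 x :=
  (coordDRho E).hasFDerivAt.comp_hasDerivAt x hc

theorem hasDerivAt_snd_comp {c : ℝ → (ℝ × ℝ) × E} {c' : (ℝ × ℝ) × E} {x : ℝ}
    (hc : HasDerivAt c c' x) : HasDerivAt (fun s => (c s).2) c'.2 x :=
  (ContinuousLinearMap.snd ℝ (ℝ × ℝ) E).hasFDerivAt.comp_hasDerivAt x hc

theorem hasDerivAt_inv_line (ht : t ≠ 0) (a : ℝ) :
    HasDerivAt (fun s : ℝ => (t + s * a)⁻¹) (-a / t ^ 2) 0 := by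
  have h1 : HasDerivAt (fun s : ℝ => t + s * a) a 0 := by
    simpa using ((hasDerivAt_id (0 : ℝ)).mul_const a).const_add t
  exact (h1.inv (by simpa using ht)).congr_deriv (by simp)

variable [FiniteDimensional ℝ E]

/-- Along a line, the Christoffel symbols of the ambient metric have the derivative that the explicit
formula has. -/
theorem hasDerivAt_christoffel_coordAmbient (ht : t ≠ 0) (h : IsMetricFamilyAt γ (0, e))
    (U X Y : (ℝ × ℝ) × E) :
    HasDerivAt (fun s : ℝ =>
      (((-((t + s * U.1.1) / 2) * paramDeriv γ (s * U.1.2, e + s • U.2) X.2 Y.2,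
        (X.1.1 * Y.1.2 + X.1.2 * Y.1.1) / (t + s * U.1.1) - γ (s * U.1.2, e + s • U.2) X.2 Y.2
          + s * U.1.2 * paramDeriv γ (s * U.1.2, e + s • U.2) X.2 Y.2),
        (t + s * U.1.1)⁻¹ • (X.1.1 • Y.2 + Y.1.1 • X.2)
          + christoffel (fun y => γ (s * U.1.2, y)) (e + s • U.2) X.2 Y.2
          + (1 / 2 : ℝ) • (X.1.2 • raise (γ (s * U.1.2, e + s • U.2))
              (paramDeriv γ (s * U.1.2, e + s • U.2)) Y.2
            + Y.1.2 • raise (γ (s * U.1.2, e + s • U.2))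
              (paramDeriv γ (s * U.1.2, e + s • U.2)) X.2)) : (ℝ × ℝ) × E))
      (fderiv ℝ (christoffel (coordAmbient γ)) ((t, 0), e) U X Y) 0 := by
  have : CompleteSpace E := FiniteDimensional.complete ℝ E
  have h1 := (coordAmbient_isMetricAt (p := ((t, 0), e)) ht h).hasDerivAt_christoffel_line U X Y
  refine h1.congr_of_eventuallyEq ?_
  filter_upwards [eventually_line ht h U] with s hs
  rw [christoffel_coordAmbient (by simpa using hs.1) (by simpa using hs.2)]
  simp

/-- The t-component of Γ(X, Y) is −(t/2)γ'(v, v'), with t-derivative −γ'(v, v')/2. The term Γ(X,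
Γ(∂_t, Y)) cancels it, since Γ(∂_t, ·) scales the `E`-component of Y by 1/t. -/
theorem coordCurvature_coordAmbient_dt (ht : t ≠ 0) (h : IsMetricFamilyAt γ (0, e))
    (a a' : ℝ) (v v' : E) :
    (coordCurvature (coordAmbient γ) ((t, 0), e) ((1, 0), 0) ((a, 0), v) ((a', 0), v')).1.1 = 0 := by
  have h1 : (fderiv ℝ (christoffel (coordAmbient γ)) ((t, 0), e) ((1, 0), 0) ((a, 0), v)
      ((a', 0), v')).1.1 = -(1 / 2) * paramDeriv γ (0, e) v v' := by
    have := hasDerivAt_fst_fst (hasDerivAt_christoffel_coordAmbient ht h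
      ((1, 0), 0) ((a, 0), v) ((a', 0), v'))
    refine this.unique ?_
    simp only [mul_zero, smul_zero, add_zero, mul_one]
    exact (((((hasDerivAt_id (0 : ℝ)).const_add t).div_const 2).neg).mul_const _)
  have h2 : (fderiv ℝ (christoffel (coordAmbient γ)) ((t, 0), e) ((a, 0), v) ((1, 0), 0)
      ((a', 0), v')).1.1 = 0 := by
    have := hasDerivAt_fst_fst (hasDerivAt_christoffel_coordAmbient ht h
      ((a, 0), v) ((1, 0), 0) ((a', 0), v'))
    refine this.unique ?_
    simpa using hasDerivAt_const (0 : ℝ) (0 : ℝ)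
  simp only [coordCurvature_apply, Prod.fst_add, Prod.fst_sub, h1, h2,
    christoffel_coordAmbient (p := ((t, 0), e)) ht h]
  simp
  field_simp
  ring

/-- The ρ-component of Γ contains −γ + ργ', whose ρ-derivative at 0 is −γ' + γ' = 0, so γ'' never
appears; the remaining terms cancel in pairs. -/
theorem coordCurvature_coordAmbient_dRho (ht : t ≠ 0) (h : IsMetricFamilyAt γ (0, e))
    (a a' : ℝ) (v v' : E) :
    (coordCurvature (coordAmbient γ) ((t, 0), e) ((0, 1), 0) ((a, 0), v) ((a', 0), v')).1.2 = 0 := by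
  have h1 : (fderiv ℝ (christoffel (coordAmbient γ)) ((t, 0), e) ((0, 1), 0) ((a, 0), v)
      ((a', 0), v')).1.2 = 0 := by
    have := hasDerivAt_fst_snd (hasDerivAt_christoffel_coordAmbient ht h
      ((0, 1), 0) ((a, 0), v) ((a', 0), v'))
    refine this.unique ?_
    simp only [mul_zero, smul_zero, add_zero, mul_one, zero_mul, zero_div, zero_sub]
    -- Differentiability of γ' suffices: its derivative is multiplied by s = 0.
    have hd : DifferentiableAt ℝ (fun s : ℝ => paramDeriv γ (s, e) v v') 0 := by
      have h2 : DifferentiableAt ℝ (fderiv ℝ γ) (0, e) :=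
        (h.contDiffAt.fderiv_right (m := 1) (by norm_num)).differentiableAt (by simp)
      have h3 : DifferentiableAt ℝ (fun s : ℝ => fderiv ℝ γ (s, e)) 0 :=
        h2.comp (0 : ℝ) (differentiableAt_id.prodMk (differentiableAt_const e))
      exact ((h3.clm_apply (differentiableAt_const (1, 0))).clm_apply
        (differentiableAt_const v)).clm_apply (differentiableAt_const v')
    refine ((h.hasDerivAt_param v v').neg.add ((hasDerivAt_id (0 : ℝ)).mul hd.hasDerivAt)).congr_deriv ?_
    simp
  have h2 : (fderiv ℝ (christoffel (coordAmbient γ)) ((t, 0), e) ((a, 0), v) ((0, 1), 0)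
      ((a', 0), v')).1.2 = -a * a' / t ^ 2 := by
    have := hasDerivAt_fst_snd (hasDerivAt_christoffel_coordAmbient ht h
      ((a, 0), v) ((0, 1), 0) ((a', 0), v'))
    refine this.unique ?_
    simpa [div_eq_mul_inv, mul_comm, mul_left_comm, mul_assoc] 
      using (hasDerivAt_inv_line ht a).const_mul a'
  simp only [coordCurvature_apply, Prod.fst_add, Prod.fst_sub, Prod.snd_add, Prod.snd_sub, h1, h2,
    christoffel_coordAmbient (p := ((t, 0), e)) ht h]
  simp [raise_apply h.isInvertible, h.symm_apply v]
  rw [show paramDeriv γ (0, e) v' v = paramDeriv γ (0, e) v v' from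
    h.fderiv_apply_symm (1, 0) v' v]
  field_simp
  ring

/-- Along ρ = 0 the `E`-part of Γ(X, Y) involves no raised form, so no inverse metric other than
that inside the Christoffel symbols of γ(0) is differentiated. The corrections come from the t- and
ρ-components of the inner Γ: they act on u by 1/t and by half the raised γ'. -/
theorem coordCurvature_coordAmbient_snd (ht : t ≠ 0) (h : IsMetricFamilyAt γ (0, e))
    (a a' : ℝ) (u v v' : E) :
    (coordCurvature (coordAmbient γ) ((t, 0), e) ((0, 0), u) ((a, 0), v) ((a', 0), v')).2 =
      coordCurvature (fun y => γ (0, y)) e u v v'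
        - (1 / 2 : ℝ) • (paramDeriv γ (0, e) v v' • u
          + γ (0, e) v v' • raise (γ (0, e)) (paramDeriv γ (0, e)) u
          - paramDeriv γ (0, e) u v' • v
          - γ (0, e) u v' • raise (γ (0, e)) (paramDeriv γ (0, e)) v) := by
  have : CompleteSpace E := FiniteDimensional.complete ℝ E
  have h1 : (fderiv ℝ (christoffel (coordAmbient γ)) ((t, 0), e) ((0, 0), u) ((a, 0), v)
      ((a', 0), v')).2 = fderiv ℝ (christoffel fun y => γ (0, y)) e u v v' := by
    have := hasDerivAt_snd_comp (hasDerivAt_christoffel_coordAmbient ht h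
      ((0, 0), u) ((a, 0), v) ((a', 0), v'))
    refine this.unique ?_
    simpa using (h.isMetricAt.hasDerivAt_christoffel_line u v v').const_add (t⁻¹ • (a • v' + a' • v))
  have h2 : (fderiv ℝ (christoffel (coordAmbient γ)) ((t, 0), e) ((a, 0), v) ((0, 0), u)
      ((a', 0), v')).2 = (-(a * a') / t ^ 2) • u
        + fderiv ℝ (christoffel fun y => γ (0, y)) e v u v' := by
    have := hasDerivAt_snd_comp (hasDerivAt_christoffel_coordAmbient ht h
      ((a, 0), v) ((0, 0), u) ((a', 0), v'))
    refine this.unique ?_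
    have h3 := ((hasDerivAt_inv_line ht a).smul_const (a' • u)).add
      (h.isMetricAt.hasDerivAt_christoffel_line v u v')
    simp only [mul_zero, zero_smul, add_zero, smul_zero, zero_add]
    refine h3.congr_deriv ?_
    rw [smul_smul]
    congr 2
    ring
  simp only [coordCurvature_apply, Prod.snd_add, Prod.snd_sub, h1, h2,
    christoffel_coordAmbient (p := ((t, 0), e)) ht h]
  simp [h.isMetricAt.christoffel_symm v u]
  match_scalars <;> field_simp <;> ring

theorem coordRicci_coordAmbient (ht : t ≠ 0) (h : IsMetricFamilyAt γ (0, e))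
    (a a' : ℝ) (v v' : E) :
    coordRicci (coordAmbient γ) ((t, 0), e) ((a, 0), v) ((a', 0), v') =
      coordRicci (fun y => γ (0, y)) e v v'
        - ((Module.finrank ℝ E : ℝ) - 2) / 2 * paramDeriv γ (0, e) v v'
        - 1 / 2 * traceL (raise (γ (0, e)) (paramDeriv γ (0, e))) * γ (0, e) v v' := by
  have key : ContinuousLinearMap.snd ℝ (ℝ × ℝ) E ∘L
      (((coordCurvature (coordAmbient γ) ((t, 0), e)).flip ((a, 0), v)).flip ((a', 0), v')) ∘L
        ContinuousLinearMap.inr ℝ (ℝ × ℝ) E =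
      ((coordCurvature (fun y => γ (0, y)) e).flip v).flip v'
        - (1 / 2 : ℝ) • (paramDeriv γ (0, e) v v' • ContinuousLinearMap.id ℝ E
          + γ (0, e) v v' • raise (γ (0, e)) (paramDeriv γ (0, e))
          - ((paramDeriv γ (0, e)).flip v').smulRight v
          - ((γ (0, e)).flip v').smulRight (raise (γ (0, e)) (paramDeriv γ (0, e)) v)) :=
    ContinuousLinearMap.ext fun u => coordCurvature_coordAmbient_snd ht h a a' u v v'
  rw [coordRicci_eq_traceL, traceL_prod, traceL_prod, key]
  simp only [traceL_real, ContinuousLinearMap.comp_apply, ContinuousLinearMap.inl_apply,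
    ContinuousLinearMap.inr_apply, ContinuousLinearMap.coe_fst', ContinuousLinearMap.coe_snd',
    ContinuousLinearMap.flip_apply]
  rw [coordCurvature_coordAmbient_dt ht h, coordCurvature_coordAmbient_dRho ht h]
  -- The identity contributes n γ'(v, v') and each of the two rank-one maps removes one γ'(v, v'),
  -- which produces n − 2.
  simp only [map_add, map_sub, map_smul, traceL_id, traceL_smulRight, smul_eq_mul,
    coordRicci_eq_traceL, ContinuousLinearMap.flip_apply, raise_apply h.isInvertible]
  ring

/-- If the family has first derivative twice the Schouten tensor, then the ambient metric is Ricci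
flat in the directions of the hypersurface `ρ = 0`. -/
theorem coordRicci_coordAmbient_eq_zero (hn : 3 ≤ Module.finrank ℝ E) (ht : t ≠ 0)
    (h : IsMetricFamilyAt γ (0, e))
    (hP : paramDeriv γ (0, e) = (2 : ℝ) • coordSchouten (fun y => γ (0, y)) e)
    (a a' : ℝ) (v v' : E) :
    coordRicci (coordAmbient γ) ((t, 0), e) ((a, 0), v) ((a', 0), v') = 0 := by
  have h1 := coordRicci_sub_coordSchouten (G := fun y => γ (0, y)) hn h.isMetricAt.isInvertible
  have h2 := congrArg (fun B => B v v') h1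
  simp only [sub_apply, smul_apply, zero_apply, smul_eq_mul] at h2
  rw [coordRicci_coordAmbient ht h, hP, raise_smul, map_smul, smul_apply, smul_apply, smul_eq_mul,
    smul_eq_mul]
  linarith

end Ricci

end CoordinateAmbient

/-! ### The shape operator of a spacelike section of the hypersurface `ρ = 0` -/

section CoordinateWeingarten

variable {E : Type*} [NormedAddCommGroup E] [NormedSpace ℝ E]

/-- The immersion `y ↦ (e^{f(y)}, 0, y)`. -/
noncomputable def coordImmersion (f : E → ℝ) (y : E) : (ℝ × ℝ) × E := ((Real.exp (f y), 0), y)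

/-- The lightlike normal field `e^{-f} (|∇f|² / 2) ∂_t - e^{-2f} ∂_ρ + e^{-2f} ∇f`. -/
noncomputable def coordEta (G : E → E →L[ℝ] E →L[ℝ] ℝ) (f : E → ℝ) (y : E) : (ℝ × ℝ) × E :=
  ((Real.exp (-f y) * (G y (coordGrad G f y) (coordGrad G f y) / 2), -Real.exp (-(2 * f y))),
    Real.exp (-(2 * f y)) • coordGrad G f y)

variable {G : E → E →L[ℝ] E →L[ℝ] ℝ} {γ : ℝ × E → E →L[ℝ] E →L[ℝ] ℝ} {f : E → ℝ} {e : E}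

theorem hasFDerivAt_coordImmersion (hf : DifferentiableAt ℝ f e) :
    HasFDerivAt (coordImmersion f) (((Real.exp (f e) • fderiv ℝ f e).prod 0).prod
      (ContinuousLinearMap.id ℝ E)) e :=
  (hf.hasFDerivAt.exp.prodMk (hasFDerivAt_const 0 e)).prodMk (hasFDerivAt_id e)

/-- The immersion induces the conformal metric. -/
theorem coordAmbient_fderiv_coordImmersion (hf : DifferentiableAt ℝ f e) (v w : E) :
    coordAmbient γ (coordImmersion f e) (fderiv ℝ (coordImmersion f) e v)
      (fderiv ℝ (coordImmersion f) e w) = Real.exp (2 * f e) * γ (0, e) v w := by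
  rw [coordAmbient_apply, (hasFDerivAt_coordImmersion hf).fderiv]
  simp [coordImmersion, ← Real.exp_nat_mul]

theorem differentiableAt_coordEta [CompleteSpace E] (h : IsMetricAt G e)
    (hf : ContDiffAt ℝ 2 f e) : DifferentiableAt ℝ (coordEta G f) e := by
  have h1 := differentiableAt_coordGrad h hf
  have h2 := hf.differentiableAt (by simp)
  have h3 := (h.differentiableAt.clm_apply h1).clm_apply h1
  have h4 : DifferentiableAt ℝ (fun y => G y (coordGrad G f y) (coordGrad G f y) / 2) e := by
    simpa only [div_eq_mul_inv] using h3.mul_const (2⁻¹ : ℝ)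
  exact ((h2.neg.exp.mul h4).prodMk (h2.const_mul 2).neg.exp.neg).prodMk
    ((h2.const_mul 2).neg.exp.smul h1)

/-- At ρ = 0, pairing with a tangent vector of the immersion, which has no ρ-component, does not see
the t-component. Hence only the ρ- and `E`-components of Dη are computed, and |∇f|² is never
differentiated. -/
theorem fderiv_coordEta_fst_snd [CompleteSpace E] (h : IsMetricAt G e)
    (hf : ContDiffAt ℝ 2 f e) (v : E) :
    (fderiv ℝ (coordEta G f) e v).1.2 = 2 * Real.exp (-(2 * f e)) * fderiv ℝ f e v := by
  have h1 := (coordDRho E).hasFDerivAt.comp e (differentiableAt_coordEta h hf).hasFDerivAt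
  have h2 : HasFDerivAt (fun y => -Real.exp (-(2 * f y))) _ e :=
    ((hf.differentiableAt (by simp)).hasFDerivAt.const_mul 2).neg.exp.neg
  refine (congrArg (fun φ => φ v) (h1.unique h2)).trans ?_
  simp
  ring

theorem fderiv_coordEta_snd [CompleteSpace E] (h : IsMetricAt G e)
    (hf : ContDiffAt ℝ 2 f e) (v : E) :
    (fderiv ℝ (coordEta G f) e v).2 = Real.exp (-(2 * f e)) •
      (fderiv ℝ (coordGrad G f) e v - (2 * fderiv ℝ f e v) • coordGrad G f e) := by
  have h1 := (ContinuousLinearMap.snd ℝ (ℝ × ℝ) E).hasFDerivAt.comp e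
    (differentiableAt_coordEta h hf).hasFDerivAt
  have h2 : HasFDerivAt (fun y => Real.exp (-(2 * f y)) • coordGrad G f y) _ e :=
    ((hf.differentiableAt (by simp)).hasFDerivAt.const_mul 2).neg.exp.smul
      (differentiableAt_coordGrad h hf).hasFDerivAt
  refine (congrArg (fun φ => φ v) (h1.unique h2)).trans ?_
  simp
  module

variable [FiniteDimensional ℝ E]

/-- The Hessian comes from the covariant derivative of ∇f, and −γ'/2 from the component −e^{−2f} ∂_ρ
of η. -/
theorem coordAmbient_covariantDeriv_coordEta (h : IsMetricFamilyAt γ (0, e))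
    (hf : ContDiffAt ℝ 2 f e) (v w : E) :
    coordAmbient γ (coordImmersion f e)
      (fderiv ℝ (coordEta (fun y => γ (0, y)) f) e v +
        christoffel (coordAmbient γ) (coordImmersion f e) (fderiv ℝ (coordImmersion f) e v)
          (coordEta (fun y => γ (0, y)) f e))
      (fderiv ℝ (coordImmersion f) e w) =
    coordHessian (fun y => γ (0, y)) f e v w - fderiv ℝ f e v * fderiv ℝ f e w
      + fderiv ℝ f e (coordGrad (fun y => γ (0, y)) f e) / 2 * γ (0, e) v w
      - 1 / 2 * paramDeriv γ (0, e) v w := by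
  have : CompleteSpace E := FiniteDimensional.complete ℝ E
  have hG : IsMetricAt (fun y => γ (0, y)) e := h.isMetricAt
  have hp : (coordImmersion f e).1.1 ≠ 0 := Real.exp_ne_zero _
  have hZ := fun v => coordGrad_spec (G := fun y => γ (0, y)) (f := f) hG.isInvertible v
  have hH := covariantDeriv_coordGrad hG hf v w
  -- All exponentials become powers of e^{f}, so that the identity is rational in one nonzero
  -- quantity.
  have hE : Real.exp (-(2 * f e)) = (Real.exp (f e) ^ 2)⁻¹ := by
    rw [Real.exp_neg, ← Real.exp_nat_mul]; norm_num
  have hE' : Real.exp (-f e) = (Real.exp (f e))⁻¹ := Real.exp_neg _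
  have h0 := Real.exp_ne_zero (f e)
  rw [christoffel_coordAmbient hp h, coordAmbient_apply,
    (hasFDerivAt_coordImmersion (hf.differentiableAt (by simp))).fderiv]
  simp only [Prod.fst_add, Prod.snd_add, fderiv_coordEta_fst_snd hG hf, fderiv_coordEta_snd hG hf,
    ContinuousLinearMap.prod_apply, ContinuousLinearMap.id_apply, smul_apply, smul_eq_mul]
  simp only [map_add, add_apply] at hH
  simp only [coordImmersion, coordEta, hE, hE', map_add, map_sub, map_smul, add_apply, sub_apply,
    smul_apply, smul_eq_mul, hZ, raise_apply h.isInvertible, zero_apply, ← hH,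
    h.symm_apply v (coordGrad (fun y => γ (0, y)) f e)]
  field_simp
  ring

/-- If the family has first derivative twice the Schouten tensor, then the second fundamental form
is minus the Schouten tensor of the induced metric. -/
theorem coordAmbient_covariantDeriv_coordEta_eq (hn : 3 ≤ Module.finrank ℝ E)
    (h : IsMetricFamilyAt γ (0, e)) (hf : ContDiffAt ℝ 2 f e)
    (hP : paramDeriv γ (0, e) = (2 : ℝ) • coordSchouten (fun y => γ (0, y)) e) (v w : E) :
    coordAmbient γ (coordImmersion f e)
      (fderiv ℝ (coordEta (fun y => γ (0, y)) f) e v +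
        christoffel (coordAmbient γ) (coordImmersion f e) (fderiv ℝ (coordImmersion f) e v)
          (coordEta (fun y => γ (0, y)) f e))
      (fderiv ℝ (coordImmersion f) e w) =
    -coordSchouten (fun y => Real.exp (2 * f y) • γ (0, y)) e v w := by
  rw [coordAmbient_covariantDeriv_coordEta h hf, hP, coordSchouten_exp_smul hn h.isMetricAt hf,
    smul_apply, smul_apply, smul_eq_mul]
  ring

end CoordinateWeingarten

/-! ### Metrics on a manifold in charts -/

section Charts

variable {E : Type*} [NormedAddCommGroup E] [NormedSpace ℝ E]
  {H : Type*} [TopologicalSpace H] {I : ModelWithCorners ℝ E H}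
  {M : Type*} [TopologicalSpace M] [ChartedSpace H M]

/-- All tangent spaces are `E` by definition, so base point and vectors can be replaced at once
where rewriting the base point alone would break the dependent types. -/
theorem formField_congr (g : FormField I M) {x y : M} (h : y = x) {v w v' w' : E} (hv : v' = v)
    (hw : w' = w) :
    (g y : E →L[ℝ] E →L[ℝ] ℝ) v' w' = (g x : E →L[ℝ] E →L[ℝ] ℝ) v w := by
  subst h hv hw
  rfl

theorem coordMetric_apply (g : FormField I M) (x : M) (e v w : E) :
    coordMetric I g x e v w = g ((extChartAt I x).symm e)
      (mfderiv 𝓘(ℝ, E) I (extChartAt I x).symm e v)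
      (mfderiv 𝓘(ℝ, E) I (extChartAt I x).symm e w) := rfl

theorem mfderiv_extChartAt_center [IsManifold I 1 M] (x : M) :
    mfderiv I 𝓘(ℝ, E) (extChartAt I x) x = ContinuousLinearMap.id ℝ E :=
  mfderiv_extChartAt_self

/-- The chart at `x` is the one that identifies the tangent space at `x` with `E`, so its
differential there is the identity. -/
theorem ricci_eq_coordRicci [IsManifold I 1 M] [FiniteDimensional ℝ E] (g : FormField I M) (x : M) :
    ricci I g x = coordRicci (coordMetric I g x) (extChartAt I x x) := by
  rw [ricci, mfderiv_extChartAt_center]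
  rfl


variable [I.Boundaryless] [IsManifold I 1 M]

theorem mfderiv_extChartAt_symm_center (x : M) :
    mfderiv 𝓘(ℝ, E) I (extChartAt I x).symm (extChartAt I x x) = ContinuousLinearMap.id ℝ E := by
  have h := mfderivWithin_range_extChartAt_symm (I := I) (x := x)
  rwa [I.range_eq_univ, mfderivWithin_univ] at h

theorem mfderiv_extChartAt_comp_symm {x : M} {e : E} (he : e ∈ (extChartAt I x).target) :
    (mfderiv I 𝓘(ℝ, E) (extChartAt I x) ((extChartAt I x).symm e)) ∘L
      (mfderiv 𝓘(ℝ, E) I (extChartAt I x).symm e) = ContinuousLinearMap.id ℝ E := by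
  have h := mfderiv_extChartAt_comp_mfderivWithin_extChartAt_symm (I := I) he
  rwa [I.range_eq_univ, mfderivWithin_univ] at h

theorem mfderiv_extChartAt_symm_comp {x y : M} (hy : y ∈ (extChartAt I x).source) :
    (mfderiv 𝓘(ℝ, E) I (extChartAt I x).symm (extChartAt I x y)) ∘L
      (mfderiv I 𝓘(ℝ, E) (extChartAt I x) y) = ContinuousLinearMap.id ℝ (TangentSpace I y) := by
  have h := mfderivWithin_extChartAt_symm_comp_mfderiv_extChartAt' (I := I) hy
  rwa [I.range_eq_univ, mfderivWithin_univ] at h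

theorem mdifferentiableAt_extChartAt_symm {x : M} {e : E} (he : e ∈ (extChartAt I x).target) :
    MDifferentiableAt 𝓘(ℝ, E) I (extChartAt I x).symm e := by
  have h := mdifferentiableWithinAt_extChartAt_symm (I := I) he
  rwa [I.range_eq_univ, mdifferentiableWithinAt_univ] at h

theorem coordMetric_center (g : FormField I M) (x : M) (v w : E) :
    coordMetric I g x (extChartAt I x x) v w = g x v w := by
  have hv : ∀ v : E, mfderiv 𝓘(ℝ, E) I (extChartAt I x).symm (extChartAt I x x) v = v := fun v =>
    congrArg (fun A : E →L[ℝ] E => A v) (mfderiv_extChartAt_symm_center x)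
  rw [coordMetric_apply]
  exact formField_congr g (extChartAt_to_inv x) (hv v) (hv w)

theorem coordMetric_center' (g : FormField I M) (x : M) :
    coordMetric I g x (extChartAt I x x) = g x :=
  ContinuousLinearMap.ext fun v => ContinuousLinearMap.ext fun w => coordMetric_center g x v w

variable [FiniteDimensional ℝ E]

theorem schouten_eq_coordSchouten (g : FormField I M) (x : M) :
    schouten I g x = coordSchouten (coordMetric I g x) (extChartAt I x x) := by
  rw [schouten, scalarCurvature, ricci_eq_coordRicci, coordSchouten, coordScalar,
    coordMetric_center']
  rfl

end Charts

/-! ### Smoothness in charts -/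

section Smoothness

variable {E : Type*} [NormedAddCommGroup E] [NormedSpace ℝ E]
  {H : Type*} [TopologicalSpace H] {I : ModelWithCorners ℝ E H}
  {M : Type*} [TopologicalSpace M] [ChartedSpace H M]

/-- The expression in a chart of a family of forms `g(α(ρ)·, ·)`. -/
noncomputable def coordFamily (g : FormField I M)
    (α : ℝ → ∀ x : M, TangentSpace I x →L[ℝ] TangentSpace I x) (x : M) (q : ℝ × E) :
    E →L[ℝ] E →L[ℝ] ℝ :=
  coordMetric I (fun y => g y ∘L α q.1 y) x q.2

theorem coordFamily_apply (g : FormField I M)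
    (α : ℝ → ∀ x : M, TangentSpace I x →L[ℝ] TangentSpace I x) (x : M) (q : ℝ × E) (v w : E) :
    coordFamily g α x q v w = g ((extChartAt I x).symm q.2)
      (α q.1 _ (mfderiv 𝓘(ℝ, E) I (extChartAt I x).symm q.2 v))
      (mfderiv 𝓘(ℝ, E) I (extChartAt I x).symm q.2 w) := rfl

variable [I.Boundaryless] [IsManifold I ∞ M]

/-- The coordinate vector fields of a chart are smooth. -/
theorem contMDiffOn_coordVectorField (x : M) (v : E) :
    ContMDiffOn 𝓘(ℝ, E) (I.prod 𝓘(ℝ, E)) ∞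
      (fun e : E => (⟨(extChartAt I x).symm e,
        mfderiv 𝓘(ℝ, E) I (extChartAt I x).symm e v⟩ : TangentBundle I M))
      (extChartAt I x).target := by
  have : IsManifold I 1 M := IsManifold.of_le (n := ∞) (by simp)
  have hs : ∀ e ∈ (extChartAt I x).target, (extChartAt I x).symm e ∈ (chartAt H x).source :=
    fun e he => by simpa using (extChartAt I x).map_target he
  rw [Trivialization.contMDiffOn_iff (e := trivializationAt E (TangentSpace I) x)]
  · refine ⟨contMDiffOn_extChartAt_symm x, ?_⟩
    refine contMDiffOn_const (c := v) |>.congr fun e he => ?_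
    -- The fibre coordinate of the trivialization at `x` is the differential of the chart, so in it
    -- the field is the constant `v`.
    have h1 := congrArg (fun A : E →L[ℝ] E => A v) (mfderiv_extChartAt_comp_symm he)
    rw [← TangentBundle.continuousLinearMapAt_trivializationAt (hs e he)] at h1
    refine Eq.trans ?_ h1
    have h2 := (trivializationAt E (TangentSpace I) x).coe_linearMapAt_of_mem (R := ℝ)
      (b := (extChartAt I x).symm e) (by simpa using hs e he)
    exact (congrFun h2 (mfderiv 𝓘(ℝ, E) I (extChartAt I x).symm e v)).symm
  · intro e he
    rw [Trivialization.mem_source]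
    simpa using hs e he

/-- In finite dimension, smoothness may be tested on constant vectors; these are the coordinate
fields, to which the smooth bundle maps α and g are applied. -/
theorem contDiffOn_coordFamily [FiniteDimensional ℝ E] {g : FormField I M}
    (hg : ContMDiff I (I.prod 𝓘(ℝ, E →L[ℝ] E →L[ℝ] ℝ)) ∞
      (fun x => TotalSpace.mk' (E →L[ℝ] E →L[ℝ] ℝ)
        (E := fun x : M => TangentSpace I x →L[ℝ] TangentSpace I x →L[ℝ] ℝ) x (g x)))
    {α : ℝ → ∀ x : M, TangentSpace I x →L[ℝ] TangentSpace I x} {s : Set ℝ}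
    (hα : ContMDiffOn (𝓘(ℝ, ℝ).prod I) (I.prod 𝓘(ℝ, E →L[ℝ] E)) ∞
      (fun p : ℝ × M => TotalSpace.mk' (E →L[ℝ] E)
        (E := fun x : M => TangentSpace I x →L[ℝ] TangentSpace I x) p.2 (α p.1 p.2))
      (s ×ˢ univ)) (x : M) :
    ContDiffOn ℝ ∞ (coordFamily g α x) (s ×ˢ (extChartAt I x).target) := by
  have hsymm : ContMDiffOn 𝓘(ℝ, ℝ × E) I ∞ (fun q : ℝ × E => (extChartAt I x).symm q.2)
      (s ×ˢ (extChartAt I x).target) :=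
    (contMDiffOn_extChartAt_symm x).comp contDiff_snd.contMDiff.contMDiffOn fun q hq => hq.2
  have hD : ∀ v : E, ContMDiffOn 𝓘(ℝ, ℝ × E) (I.prod 𝓘(ℝ, E)) ∞
      (fun q : ℝ × E => (⟨(extChartAt I x).symm q.2,
        mfderiv 𝓘(ℝ, E) I (extChartAt I x).symm q.2 v⟩ : TangentBundle I M))
      (s ×ˢ (extChartAt I x).target) := fun v =>
    (contMDiffOn_coordVectorField x v).comp contDiff_snd.contMDiff.contMDiffOn fun q hq => hq.2
  have hα' := hα.comp (contDiff_fst.contMDiff.contMDiffOn.prodMk hsymm)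
    (s := s ×ˢ (extChartAt I x).target) fun q hq => ⟨hq.1, mem_univ _⟩
  have hg' := hg.comp_contMDiffOn hsymm
  refine contDiffOn_clm_apply.2 fun v => contDiffOn_clm_apply.2 fun w => ?_
  have hv := ContMDiffOn.clm_bundle_apply hα' (hD v)
  have h := ContMDiffOn.clm_bundle_apply₂ (F₃ := ℝ) (E₃ := Bundle.Trivial M ℝ) hg' hv (hD w)
  rw [← contMDiffOn_iff_contDiffOn]
  intro q hq
  have h1 := h q hq
  rw [contMDiffWithinAt_totalSpace] at h1
  exact h1.2

end Smoothness

/-! ### The ambient metric in charts -/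

section AmbientCharts

variable {E : Type*} [NormedAddCommGroup E] [NormedSpace ℝ E]
  {H : Type*} [TopologicalSpace H] {I : ModelWithCorners ℝ E H}
  {M : Type*} [TopologicalSpace M] [ChartedSpace H M] {ε : ℝ}

theorem contMDiff_stripVal :
    ContMDiff (ambientModel I) 𝓘(ℝ, ℝ × ℝ) ∞ (fun p : Ambient ε M => (p.1 : ℝ × ℝ)) :=
  contMDiff_subtype_val.comp contMDiff_fst

theorem mdifferentiableAt_tFun (p : Ambient ε M) :
    MDifferentiableAt (ambientModel I) 𝓘(ℝ, ℝ) tFun p :=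
  ((contDiff_fst.contMDiff.comp contMDiff_stripVal).mdifferentiable (by simp)) p

theorem mdifferentiableAt_rhoFun (p : Ambient ε M) :
    MDifferentiableAt (ambientModel I) 𝓘(ℝ, ℝ) rhoFun p :=
  ((contDiff_snd.contMDiff.comp contMDiff_stripVal).mdifferentiable (by simp)) p

theorem mdifferentiableAt_rhoFun_mul_tFun (p : Ambient ε M) :
    MDifferentiableAt (ambientModel I) 𝓘(ℝ, ℝ) (fun q : Ambient ε M => rhoFun q * tFun q) p :=
  (((contDiff_snd.mul contDiff_fst).contMDiff.comp contMDiff_stripVal).mdifferentiable (by simp)) p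

theorem ambientMetric_apply (g : FormField I M)
    (α : ℝ → ∀ x : M, TangentSpace I x →L[ℝ] TangentSpace I x) (p : Ambient ε M)
    {X Y : TangentSpace (ambientModel I) p} {a b a' b' : ℝ} {V W : TangentSpace I p.2}
    (ha : mfderiv (ambientModel I) 𝓘(ℝ, ℝ) tFun p X = a)
    (ha' : mfderiv (ambientModel I) 𝓘(ℝ, ℝ) tFun p Y = a')
    (hb : mfderiv (ambientModel I) 𝓘(ℝ, ℝ) (fun q : Ambient ε M => rhoFun q * tFun q) p X = b)
    (hb' : mfderiv (ambientModel I) 𝓘(ℝ, ℝ) (fun q : Ambient ε M => rhoFun q * tFun q) p Y = b')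
    (hV : mfderiv (ambientModel I) I Prod.snd p X = V)
    (hW : mfderiv (ambientModel I) I Prod.snd p Y = W) :
    ambientMetric I g α ε p X Y =
      b * a' + a * b' + tFun p ^ 2 * g p.2 (α (rhoFun p) p.2 V) W := by
  subst ha ha' hb hb' hV hW
  rfl

theorem extChartAt_ambient_symm_snd (p : Ambient ε M) (q : (ℝ × ℝ) × E) :
    ((extChartAt (ambientModel I) p).symm q).2 = (extChartAt I p.2).symm q.2 := rfl

/-- The inverse of the inclusion of the strip is meaningful only on the target of the chart, unlike
the second component, which agrees everywhere by definition. -/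
theorem extChartAt_ambient_symm_fst (p : Ambient ε M) {q : (ℝ × ℝ) × E}
    (hq : q ∈ (extChartAt (ambientModel I) p).target) :
    (((extChartAt (ambientModel I) p).symm q).1 : ℝ × ℝ) = q.1 :=
  congrArg Prod.fst ((extChartAt (ambientModel I) p).right_inv hq)

theorem extChartAt_ambient_target_snd (p : Ambient ε M) {q : (ℝ × ℝ) × E}
    (hq : q ∈ (extChartAt (ambientModel I) p).target) : q.2 ∈ (extChartAt I p.2).target := by
  rw [extChartAt_prod] at hq
  exact hq.2

variable [I.Boundaryless] [IsManifold I ∞ M]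

/-- In a chart, the ambient metric is the ambient metric of the family of coordinate metrics. -/
theorem coordMetric_ambientMetric (g : FormField I M)
    (α : ℝ → ∀ x : M, TangentSpace I x →L[ℝ] TangentSpace I x) (p : Ambient ε M)
    {q : (ℝ × ℝ) × E} (hq : q ∈ (extChartAt (ambientModel I) p).target) :
    coordMetric (ambientModel I) (ambientMetric I g α ε) p q =
      coordAmbient (coordFamily g α p.2) q := by
  have : IsManifold (ambientModel I) 1 (Ambient ε M) := IsManifold.of_le (n := ∞) (by simp)
  have : IsManifold I 1 M := IsManifold.of_le (n := ∞) (by simp)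
  set Φ := extChartAt (ambientModel I) p with hΦ
  have hd : MDifferentiableAt 𝓘(ℝ, (ℝ × ℝ) × E) (ambientModel I) Φ.symm q :=
    mdifferentiableAt_extChartAt_symm hq
  have hnhds : Φ.target ∈ 𝓝 q := (isOpen_extChartAt_target p).mem_nhds hq
  -- Chain rule: the pull-back of `dF` under the inverse chart is the derivative of the local
  -- expression `F'`. It is applied to t and ρt.
  have key : ∀ {F : Ambient ε M → ℝ} {F' : (ℝ × ℝ) × E → ℝ} {L : (ℝ × ℝ) × E →L[ℝ] ℝ},
      MDifferentiableAt (ambientModel I) 𝓘(ℝ, ℝ) F (Φ.symm q) →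
      (∀ y ∈ Φ.target, F (Φ.symm y) = F' y) → HasFDerivAt F' L q →
      ∀ X : (ℝ × ℝ) × E, mfderiv (ambientModel I) 𝓘(ℝ, ℝ) F (Φ.symm q)
        (mfderiv 𝓘(ℝ, (ℝ × ℝ) × E) (ambientModel I) Φ.symm q X) = L X := by
    intro F F' L hF hFF' hL X
    have h1 : HasFDerivAt (F ∘ Φ.symm) L q :=
      hL.congr_of_eventuallyEq (Filter.eventuallyEq_of_mem hnhds hFF')
    have h2 := mfderiv_comp q hF hd
    rw [mfderiv_eq_fderiv, h1.fderiv] at h2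
    exact (congrArg (fun A : (ℝ × ℝ) × E →L[ℝ] ℝ => A X) h2).symm
  have ht := key (mdifferentiableAt_tFun _) (F' := fun y => y.1.1)
    (fun y hy => congrArg Prod.fst (extChartAt_ambient_symm_fst p hy)) (coordDT E).hasFDerivAt
  have hr := key (mdifferentiableAt_rhoFun_mul_tFun _) (F' := fun y => y.1.2 * y.1.1)
    (fun y hy => congrArg (fun z : ℝ × ℝ => z.2 * z.1) (extChartAt_ambient_symm_fst p hy))
    ((coordDRho E).hasFDerivAt.mul (coordDT E).hasFDerivAt)
  have hπ : ∀ X : (ℝ × ℝ) × E, mfderiv (ambientModel I) I Prod.snd (Φ.symm q)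
      (mfderiv 𝓘(ℝ, (ℝ × ℝ) × E) (ambientModel I) Φ.symm q X) =
      mfderiv 𝓘(ℝ, E) I (extChartAt I p.2).symm q.2 X.2 := by
    intro X
    have h1 := mfderiv_comp (I := 𝓘(ℝ, (ℝ × ℝ) × E)) (I' := ambientModel I) (I'' := I)
      (g := Prod.snd) q mdifferentiableAt_snd hd
    have h2 := mfderiv_comp (I := 𝓘(ℝ, (ℝ × ℝ) × E)) (I' := 𝓘(ℝ, E)) (I'' := I)
      (g := (extChartAt I p.2).symm) (f := Prod.snd) q
      (mdifferentiableAt_extChartAt_symm (extChartAt_ambient_target_snd p hq))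
      differentiableAt_snd.mdifferentiableAt
    rw [mfderiv_eq_fderiv, fderiv_snd] at h2
    have h3 := h1.symm.trans h2
    exact congrArg (fun A : (ℝ × ℝ) × E →L[ℝ] E => A X) h3
  have htq : tFun (Φ.symm q) = q.1.1 := congrArg Prod.fst (extChartAt_ambient_symm_fst p hq)
  have hrq : rhoFun (Φ.symm q) = q.1.2 := congrArg Prod.snd (extChartAt_ambient_symm_fst p hq)
  refine ContinuousLinearMap.ext fun X => ContinuousLinearMap.ext fun Y => ?_
  rw [coordMetric_apply, coordAmbient_apply, coordFamily_apply]
  refine (ambientMetric_apply g α _ (ht X) (ht Y) (hr X) (hr Y) (hπ X) (hπ Y)).trans ?_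
  rw [htq, hrq, extChartAt_ambient_symm_snd]
  simp [coordDT, coordDRho]
  ring

end AmbientCharts

/-! ### The chart family of a metric and vectors tangent to ρ = 0. -/

section Geometry

variable {E : Type*} [NormedAddCommGroup E] [NormedSpace ℝ E]
  {H : Type*} [TopologicalSpace H] {I : ModelWithCorners ℝ E H}
  {M : Type*} [TopologicalSpace M] [ChartedSpace H M] {ε : ℝ}

theorem coordFamily_zero {g : FormField I M}
    {α : ℝ → ∀ x : M, TangentSpace I x →L[ℝ] TangentSpace I x}
    (hα : ∀ x : M, α 0 x = ContinuousLinearMap.id ℝ (TangentSpace I x)) (x : M) :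
    (fun e => coordFamily g α x (0, e)) = coordMetric I g x := by
  funext e
  simp only [coordFamily, hα]
  rfl

/-- The derivative of a function in terms of its expression in the chart at the point. -/
theorem mfderiv_eq_fderiv_of_chart [IsManifold I 1 M] {F : Type*} [NormedAddCommGroup F]
    [NormedSpace ℝ F] {f : M → F} {k : E → F} {x : M}
    (hk : DifferentiableAt ℝ k (extChartAt I x x)) (hf : f =ᶠ[𝓝 x] k ∘ extChartAt I x) :
    mfderiv I 𝓘(ℝ, F) f x = fderiv ℝ k (extChartAt I x x) := by
  have h1 := mfderiv_comp (I := I) (I' := 𝓘(ℝ, E)) (I'' := 𝓘(ℝ, F)) x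
    hk.mdifferentiableAt (mdifferentiableAt_extChartAt (I := I) (mem_chart_source H x))
  rw [hf.mfderiv_eq, h1, mfderiv_extChartAt_center, mfderiv_eq_fderiv]
  exact ContinuousLinearMap.comp_id _

theorem contDiffOn_comp_extChartAt_symm [IsManifold I ∞ M] (u : C^∞⟮I, M; ℝ⟯) (x : M) :
    ContDiffOn ℝ ∞ (u ∘ (extChartAt I x).symm) (extChartAt I x).target :=
  contMDiffOn_iff_contDiffOn.1 (u.contMDiff.comp_contMDiffOn (contMDiffOn_extChartAt_symm x))

theorem metric_isInvertible [IsManifold I ∞ M] [FiniteDimensional ℝ E] (g : RiemannianMetricOn I M) (x : M) :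
    ContinuousLinearMap.IsInvertible (g.inner x : E →L[ℝ] E →L[ℝ] ℝ) := by
  refine isInvertible_of_nondegenerate (E := E) fun v hv => ?_
  by_contra hv'
  exact (g.pos x v hv').ne' (hv v)

/-- The ρ-component of a vector tangent to a map into the hypersurface `ρ = 0` vanishes. -/
theorem mfderiv_fst_snd_eq_zero [IsManifold I ∞ M] {E₁ : Type*} [NormedAddCommGroup E₁] [NormedSpace ℝ E₁]
    {H₁ : Type*} [TopologicalSpace H₁] {I₁ : ModelWithCorners ℝ E₁ H₁}
    {N : Type*} [TopologicalSpace N] [ChartedSpace H₁ N] {F : N → Ambient ε M}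
    (hF : ∀ y, rhoFun (F y) = 0) {y : N} (hd : MDifferentiableAt I₁ (ambientModel I) F y)
    (ξ : TangentSpace I₁ y) :
    (mfderiv I₁ (ambientModel I) F y ξ : (ℝ × ℝ) × E).1.2 = 0 := by
  have : IsManifold (ambientModel I) 1 (Ambient ε M) := IsManifold.of_le (n := ∞) (by simp)
  have h1 : mfderiv (ambientModel I) 𝓘(ℝ, ℝ) (rhoFun : Ambient ε M → ℝ) (F y) = coordDRho E := by
    refine (mfderiv_eq_fderiv_of_chart (I := ambientModel I) (f := rhoFun) (k := coordDRho E)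
      (coordDRho E).differentiableAt (Filter.Eventually.of_forall fun m => rfl)).trans ?_
    exact ContinuousLinearMap.fderiv _
  have h2 := mfderiv_comp y (mdifferentiableAt_rhoFun (F y)) hd
  have h3 : (rhoFun ∘ F : N → ℝ) = fun _ => 0 := funext hF
  rw [h3, mfderiv_const, h1] at h2
  exact (congrArg (fun A : E₁ →L[ℝ] ℝ => A ξ) h2).symm

variable [I.Boundaryless] [IsManifold I ∞ M]

theorem contDiffAt_comp_extChartAt_symm (u : C^∞⟮I, M; ℝ⟯) {x : M} {e : E}
    (he : e ∈ (extChartAt I x).target) : ContDiffAt ℝ 2 (u ∘ (extChartAt I x).symm) e :=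
  ((contDiffOn_comp_extChartAt_symm u x).contDiffAt
    ((isOpen_extChartAt_target x).mem_nhds he)).of_le (by norm_cast)

variable [FiniteDimensional ℝ E]

/-- A smooth family of positive definite selfadjoint endomorphisms gives a family of coordinate
metrics. -/
theorem isMetricFamilyAt_coordFamily (g : RiemannianMetricOn I M)
    {α : ℝ → ∀ x : M, TangentSpace I x →L[ℝ] TangentSpace I x} {s : Set ℝ} (hs : IsOpen s)
    (hα_smooth : ContMDiffOn (𝓘(ℝ, ℝ).prod I) (I.prod 𝓘(ℝ, E →L[ℝ] E)) ∞
      (fun p : ℝ × M => TotalSpace.mk' (E →L[ℝ] E)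
        (E := fun x : M => TangentSpace I x →L[ℝ] TangentSpace I x) p.2 (α p.1 p.2))
      (s ×ˢ univ))
    (hα_symm : ∀ ρ ∈ s, ∀ (x : M) (v w : TangentSpace I x),
      g.inner x (α ρ x v) w = g.inner x v (α ρ x w))
    (hα_pos : ∀ ρ ∈ s, ∀ (x : M) (v : TangentSpace I x), v ≠ 0 → 0 < g.inner x (α ρ x v) v)
    (x : M) {q : ℝ × E} (hq : q ∈ s ×ˢ (extChartAt I x).target) :
    IsMetricFamilyAt (coordFamily g.inner α x) q := by
  have : IsManifold I 1 M := IsManifold.of_le (n := ∞) (by simp)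
  have hq' : s ×ˢ (extChartAt I x).target ∈ 𝓝 q :=
    (hs.prod (isOpen_extChartAt_target x)).mem_nhds hq
  refine ⟨((contDiffOn_coordFamily g.contMDiff hα_smooth x).contDiffAt hq').of_le
    (by norm_cast), ?_, ?_⟩
  · filter_upwards [hq'] with y hy v w
    rw [coordFamily_apply, coordFamily_apply, hα_symm _ hy.1, g.symm]
  · filter_upwards [hq'] with y hy
    refine isInvertible_of_nondegenerate fun v hv => ?_
    -- Testing with w = v, positivity kills the image of `v`; the differential of the chart is a
    -- left inverse, so `v` vanishes.
    have h1 : mfderiv 𝓘(ℝ, E) I (extChartAt I x).symm y.2 v = 0 := by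
      by_contra h
      exact (hα_pos _ hy.1 _ _ h).ne' (hv v)
    have h2 := congrArg (fun A : E →L[ℝ] E => A v) (mfderiv_extChartAt_comp_symm hy.2)
    exact h2.symm.trans ((congrArg (mfderiv I 𝓘(ℝ, E) (extChartAt I x)
      ((extChartAt I x).symm y.2)) h1).trans (map_zero _))

/-- At the centre of the chart the family is ρ ↦ g_x(α(ρ)·, ·) with g_x fixed, so differentiation
passes through g_x, which undoes the raising of the index. -/
theorem paramDeriv_coordFamily (g : RiemannianMetricOn I M)
    {α : ℝ → ∀ x : M, TangentSpace I x →L[ℝ] TangentSpace I x} {x : M}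
    {S : TangentSpace I x →L[ℝ] TangentSpace I x →L[ℝ] ℝ}
    (hα_deriv : ∀ v : TangentSpace I x, HasDerivAt (fun ρ => α ρ x v)
      ((2 : ℝ) • raise (g.inner x) S v) 0)
    (h : IsMetricFamilyAt (coordFamily g.inner α x) (0, extChartAt I x x)) :
    paramDeriv (coordFamily g.inner α x) (0, extChartAt I x x) = (2 : ℝ) • S := by
  have : IsManifold I 1 M := IsManifold.of_le (n := ∞) (by simp)
  refine ContinuousLinearMap.ext fun v => ContinuousLinearMap.ext fun w => ?_
  have h1 : HasDerivAt (fun ρ => (α ρ x v : E)) ((2 : ℝ) • raise (g.inner x) S v : E) 0 :=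
    hα_deriv v
  let B : E →L[ℝ] E →L[ℝ] ℝ := g.inner x
  have h2 := (B.flip w).hasFDerivAt.comp_hasDerivAt (0 : ℝ) h1
  have h3 := h.hasDerivAt_param v w
  have h4 : (fun ρ => coordFamily g.inner α x (ρ, extChartAt I x x) v w) =
      fun ρ => g.inner x (α ρ x v) w := by
    funext ρ
    exact coordMetric_center (fun y => g.inner y ∘L α ρ y) x v w
  rw [h4] at h3
  refine (h3.unique h2).trans ?_
  have h5 := raise_apply (E := E) (metric_isInvertible g x) S v w
  have h6 := congrArg (fun φ : E →L[ℝ] ℝ => φ w)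
    (map_smul B (2 : ℝ) (raise (g.inner x) S v : E))
  refine h6.trans ?_
  exact congrArg (fun r : ℝ => 2 * r) h5

end Geometry

/-! ### Coordinate expressions of the immersion, the normal field and the embedding of the scale
bundle. -/

section Main

variable {E : Type*} [NormedAddCommGroup E] [NormedSpace ℝ E]
  {H : Type*} [TopologicalSpace H] {I : ModelWithCorners ℝ E H}
  {M : Type*} [TopologicalSpace M] [ChartedSpace H M] {ε : ℝ}

/-- All charts of the strip are the inclusion, with identity differential everywhere; in the factor
`M` the point need not be the centre, so the differential of the chart remains. -/
theorem mfderiv_extChartAt_ambient [IsManifold I ∞ M] (p m : Ambient ε M)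
    (hm : m.2 ∈ (extChartAt I p.2).source) (X : (ℝ × ℝ) × E) :
    mfderiv (ambientModel I) 𝓘(ℝ, (ℝ × ℝ) × E) (extChartAt (ambientModel I) p) m X =
      (X.1, mfderiv I 𝓘(ℝ, E) (extChartAt I p.2) m.2 X.2) := by
  have : IsManifold I 1 M := IsManifold.of_le (n := ∞) (by simp)
  have h1 : mfderiv 𝓘(ℝ, ℝ × ℝ) 𝓘(ℝ, ℝ × ℝ) (extChartAt 𝓘(ℝ, ℝ × ℝ) p.1) m.1 =
      ContinuousLinearMap.id ℝ (ℝ × ℝ) := mfderiv_extChartAt_center m.1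
  have h2 : MDifferentiableAt 𝓘(ℝ, ℝ × ℝ) 𝓘(ℝ, ℝ × ℝ) (extChartAt 𝓘(ℝ, ℝ × ℝ) p.1) m.1 :=
    mdifferentiableAt_extChartAt (I := 𝓘(ℝ, ℝ × ℝ)) (mem_chart_source _ m.1)
  have h3 : MDifferentiableAt I 𝓘(ℝ, E) (extChartAt I p.2) m.2 :=
    mdifferentiableAt_extChartAt (I := I) (by simpa using hm)
  have h5 : MDifferentiableAt (ambientModel I) 𝓘(ℝ, (ℝ × ℝ) × E)
      (extChartAt (ambientModel I) p) m :=
    mdifferentiableAt_extChartAt (I := ambientModel I)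
      ⟨mem_chart_source (ℝ × ℝ) m.1, by simpa using hm⟩
  have h6 := (h2.hasMFDerivAt.comp m (hasMFDerivAt_fst (I := 𝓘(ℝ, ℝ × ℝ)) (I' := I) m)).mfderiv
  have h7 := (h3.hasMFDerivAt.comp m (hasMFDerivAt_snd (I := 𝓘(ℝ, ℝ × ℝ)) (I' := I) m)).mfderiv
  have h8 := ((ContinuousLinearMap.fst ℝ (ℝ × ℝ) E).hasMFDerivAt.comp m h5.hasMFDerivAt).mfderiv
  have h9 := ((ContinuousLinearMap.snd ℝ (ℝ × ℝ) E).hasMFDerivAt.comp m h5.hasMFDerivAt).mfderiv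
  rw [h1] at h6
  exact Prod.ext
    (congrArg (fun A : (ℝ × ℝ) × E →L[ℝ] ℝ × ℝ => A X) (h8.symm.trans h6))
    (congrArg (fun A : (ℝ × ℝ) × E →L[ℝ] E => A X) (h9.symm.trans h7))

theorem eta_eq (g : FormField I M) (hε : 0 < ε) (u : M → ℝ) (x : M) :
    eta I g hε u x = (((Real.exp (-u x) * (g x (grad I g u x) (grad I g u x) / 2),
      -Real.exp (-(2 * u x))), Real.exp (-(2 * u x)) • grad I g u x) : (ℝ × ℝ) × E) := by
  have h : ∀ (a b c : ℝ) (Z : E), a • (((1, 0), 0) : (ℝ × ℝ) × E) - b • (((0, 1), 0) : (ℝ × ℝ) × E)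
      + c • (((0, 0), Z) : (ℝ × ℝ) × E) = ((a, -b), c • Z) := by
    intro a b c Z
    ext <;> simp
  exact h _ _ _ _

/-- The ingredients enter as hypotheses so that coordinate expressions can be substituted by
unification inside dependent types; the final return from the chart is the identity at its centre.
-/
theorem inducedDeriv_eq {E' : Type*} [NormedAddCommGroup E'] [NormedSpace ℝ E']
    {H' : Type*} [TopologicalSpace H'] {I' : ModelWithCorners ℝ E' H'} [I'.Boundaryless]
    {M' : Type*} [TopologicalSpace M'] [ChartedSpace H' M'] [IsManifold I' 1 M']
    {g : FormField I' M'} {Ψ : M → M'} {N : ∀ x : M, TangentSpace I' (Ψ x)} {x : M}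
    {A B : E →L[ℝ] E'} {Γ : E' →L[ℝ] E' →L[ℝ] E'} {z : E'}
    (hA : mfderiv I 𝓘(ℝ, E')
      (fun y => mfderiv I' 𝓘(ℝ, E') (extChartAt I' (Ψ x)) (Ψ y) (N y)) x = A)
    (hB : mfderiv I 𝓘(ℝ, E') (extChartAt I' (Ψ x) ∘ Ψ) x = B)
    (hΓ : christoffel (coordMetric I' g (Ψ x)) (extChartAt I' (Ψ x) (Ψ x)) = Γ)
    (hz : mfderiv I' 𝓘(ℝ, E') (extChartAt I' (Ψ x)) (Ψ x) (N x) = z) (v : E) :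
    inducedDeriv I I' g Ψ N x v = A v + Γ (B v) z := by
  subst hA hB hΓ hz
  rw [inducedDeriv, mfderiv_extChartAt_symm_center]
  rfl

theorem immersion_eventuallyEq (hε : 0 < ε) (u : M → ℝ) (x : M) :
    extChartAt (ambientModel I) (immersion (M := M) hε u x) ∘ immersion hε u =ᶠ[𝓝 x]
      coordImmersion (u ∘ (extChartAt I x).symm) ∘ extChartAt I x := by
  filter_upwards [extChartAt_source_mem_nhds (I := I) x] with y hy
  simp only [Function.comp_apply, coordImmersion, (extChartAt I x).left_inv hy]
  rfl

theorem extChartAt_immersion (hε : 0 < ε) (u : M → ℝ) (x : M) :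
    extChartAt (ambientModel I) (immersion (M := M) hε u x) (immersion hε u x) =
      coordImmersion (u ∘ (extChartAt I x).symm) (extChartAt I x x) :=
  (immersion_eventuallyEq hε u x).self_of_nhds

/-- A map whose expression in charts is differentiable is differentiable. -/
theorem mdifferentiableAt_of_chart [IsManifold I ∞ M] {E' : Type*} [NormedAddCommGroup E'] [NormedSpace ℝ E']
    {H' : Type*} [TopologicalSpace H'] {I' : ModelWithCorners ℝ E' H'} [I'.Boundaryless]
    {M' : Type*} [TopologicalSpace M'] [ChartedSpace H' M'] [IsManifold I' 1 M']
    {F : M → M'} {x : M} {k : E → E'} (hk : DifferentiableAt ℝ k (extChartAt I x x))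
    (hF : extChartAt I' (F x) ∘ F =ᶠ[𝓝 x] k ∘ extChartAt I x)
    (hs : ∀ᶠ y in 𝓝 x, F y ∈ (extChartAt I' (F x)).source) :
    MDifferentiableAt I I' F x := by
  have : IsManifold I 1 M := IsManifold.of_le (n := ∞) (by simp)
  have h1 : MDifferentiableAt I 𝓘(ℝ, E') (extChartAt I' (F x) ∘ F) x :=
    (hk.mdifferentiableAt.comp x
      (mdifferentiableAt_extChartAt (I := I) (mem_chart_source H x))).congr_of_eventuallyEq hF
  refine ((mdifferentiableAt_extChartAt_symm
    (mem_extChartAt_target (I := I') (F x))).comp x h1).congr_of_eventuallyEq ?_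
  filter_upwards [hs] with y hy
  exact ((extChartAt I' (F x)).left_inv hy).symm

variable [I.Boundaryless] [IsManifold I ∞ M]

/-- Both sides represent du in the coordinate metric. The identity is needed throughout the chart
domain, because η is differentiated afterwards. -/
theorem mfderiv_extChartAt_grad [FiniteDimensional ℝ E] (g : RiemannianMetricOn I M)
    (u : C^∞⟮I, M; ℝ⟯) {x y : M} (hy : y ∈ (extChartAt I x).source)
    (h : ContinuousLinearMap.IsInvertible (coordMetric I g.inner x (extChartAt I x y))) :
    mfderiv I 𝓘(ℝ, E) (extChartAt I x) y (grad I g.inner u y) =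
      coordGrad (coordMetric I g.inner x) (u ∘ (extChartAt I x).symm) (extChartAt I x y) := by
  have : IsManifold I 1 M := IsManifold.of_le (n := ∞) (by simp)
  have hy' : (extChartAt I x).symm (extChartAt I x y) = y := (extChartAt I x).left_inv hy
  have he : extChartAt I x y ∈ (extChartAt I x).target := (extChartAt I x).map_source hy
  refine form_ext h fun w => ?_
  rw [coordGrad_spec h]
  have h1 := mfderiv_comp (I := 𝓘(ℝ, E)) (I' := I) (I'' := 𝓘(ℝ, ℝ)) (g := u)
    (extChartAt I x y) (u.contMDiff.mdifferentiable (by simp) _) (mdifferentiableAt_extChartAt_symm he)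
  rw [mfderiv_eq_fderiv] at h1
  have h2 : mfderiv 𝓘(ℝ, E) I (extChartAt I x).symm (extChartAt I x y)
      (mfderiv I 𝓘(ℝ, E) (extChartAt I x) y (grad I g.inner u y)) = grad I g.inner u y :=
    congrArg (fun A : E →L[ℝ] E => A (grad I g.inner u y)) (mfderiv_extChartAt_symm_comp hy)
  refine (formField_congr g.inner hy' h2 rfl).trans ?_
  have h3 : ∀ w : TangentSpace I y, g.inner y (grad I g.inner u y) w = mfderiv I 𝓘(ℝ, ℝ) u y w := by
    intro w
    have h4 : g.inner y ((g.inner y).inverse (mfderiv I 𝓘(ℝ, ℝ) u y)) = mfderiv I 𝓘(ℝ, ℝ) u y :=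
      (metric_isInvertible g y).self_apply_inverse _
    exact congrArg (fun A : E →L[ℝ] ℝ => A w) h4
  refine (h3 _).trans ?_
  rw [h1]
  have h4 : ∀ z, z = y → ∀ a : E, (mfderiv I 𝓘(ℝ, ℝ) u y : E →L[ℝ] ℝ) a =
      (mfderiv I 𝓘(ℝ, ℝ) u z : E →L[ℝ] ℝ) a := by
    rintro z rfl a
    rfl
  exact h4 _ hy' _

section Immersion

variable (hε : 0 < ε) (u : C^∞⟮I, M; ℝ⟯) (x : M)

theorem differentiableAt_comp_extChartAt_symm :
    DifferentiableAt ℝ (u ∘ (extChartAt I x).symm) (extChartAt I x x) :=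
  (contDiffAt_comp_extChartAt_symm u (mem_extChartAt_target x)).differentiableAt (by simp)

theorem mfderiv_extChartAt_immersion :
    mfderiv I 𝓘(ℝ, (ℝ × ℝ) × E)
      (extChartAt (ambientModel I) (immersion (M := M) hε u x) ∘ immersion hε u) x =
      fderiv ℝ (coordImmersion (u ∘ (extChartAt I x).symm)) (extChartAt I x x) := by
  have : IsManifold I 1 M := IsManifold.of_le (n := ∞) (by simp)
  exact mfderiv_eq_fderiv_of_chart
    (hasFDerivAt_coordImmersion (differentiableAt_comp_extChartAt_symm u x)).differentiableAt
    (immersion_eventuallyEq hε u x)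

theorem mdifferentiableAt_immersion :
    MDifferentiableAt I (ambientModel I) (immersion (M := M) hε u) x := by
  have : IsManifold I 1 M := IsManifold.of_le (n := ∞) (by simp)
  have : IsManifold (ambientModel I) 1 (Ambient ε M) := IsManifold.of_le (n := ∞) (by simp)
  refine mdifferentiableAt_of_chart
    (hasFDerivAt_coordImmersion (differentiableAt_comp_extChartAt_symm u x)).differentiableAt
    (immersion_eventuallyEq hε u x) ?_
  filter_upwards [extChartAt_source_mem_nhds (I := I) x] with y hy
  rw [extChartAt_source] at hy ⊢
  exact ⟨mem_chart_source (ℝ × ℝ) (immersion hε u y).1, hy⟩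

theorem mfderiv_immersion :
    mfderiv I (ambientModel I) (immersion (M := M) hε u) x =
      fderiv ℝ (coordImmersion (u ∘ (extChartAt I x).symm)) (extChartAt I x x) := by
  have : IsManifold (ambientModel I) 1 (Ambient ε M) := IsManifold.of_le (n := ∞) (by simp)
  rw [← mfderiv_extChartAt_immersion hε u x]
  have h1 := mfderiv_comp x (mdifferentiableAt_extChartAt (I := ambientModel I)
    (mem_chart_source _ (immersion (M := M) hε u x))) (mdifferentiableAt_immersion hε u x)
  rw [mfderiv_extChartAt_center] at h1
  exact h1.symm

variable [FiniteDimensional ℝ E] (g : RiemannianMetricOn I M)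

theorem eta_eventuallyEq
    (hG : ∀ e ∈ (extChartAt I x).target,
      ContinuousLinearMap.IsInvertible (coordMetric I g.inner x e)) :
    (fun y => mfderiv (ambientModel I) 𝓘(ℝ, (ℝ × ℝ) × E)
      (extChartAt (ambientModel I) (immersion (M := M) hε u x)) (immersion hε u y)
        (eta I g.inner hε u y)) =ᶠ[𝓝 x]
      coordEta (coordMetric I g.inner x) (u ∘ (extChartAt I x).symm) ∘ extChartAt I x := by
  have : IsManifold I 1 M := IsManifold.of_le (n := ∞) (by simp)
  filter_upwards [extChartAt_source_mem_nhds (I := I) x] with y hy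
  have hinv := hG _ ((extChartAt I x).map_source hy)
  have hgrad := mfderiv_extChartAt_grad g u hy hinv
  have hD := mfderiv_extChartAt_ambient (immersion (M := M) hε u x) (immersion hε u y) hy
    (eta I g.inner hε u y)
  refine hD.trans ?_
  have hy' : (extChartAt I x).symm (extChartAt I x y) = y := (extChartAt I x).left_inv hy
  have hnorm : g.inner y (grad I g.inner u y) (grad I g.inner u y) =
      coordMetric I g.inner x (extChartAt I x y)
        (coordGrad (coordMetric I g.inner x) (u ∘ (extChartAt I x).symm) (extChartAt I x y))
        (coordGrad (coordMetric I g.inner x) (u ∘ (extChartAt I x).symm) (extChartAt I x y)) := by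
    have h2 : mfderiv 𝓘(ℝ, E) I (extChartAt I x).symm (extChartAt I x y)
        (mfderiv I 𝓘(ℝ, E) (extChartAt I x) y (grad I g.inner u y)) = grad I g.inner u y :=
      congrArg (fun A : E →L[ℝ] E => A (grad I g.inner u y)) (mfderiv_extChartAt_symm_comp hy)
    rw [← hgrad]
    exact (formField_congr g.inner hy' h2 h2).symm
  have hu : (u ∘ (extChartAt I x).symm) (extChartAt I x y) = u y := congrArg u hy'
  rw [eta_eq]
  have hlin : ∀ (c : ℝ) (Z : E), mfderiv I 𝓘(ℝ, E) (extChartAt I x) y (c • Z : E) =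
      c • (mfderiv I 𝓘(ℝ, E) (extChartAt I x) y Z : E) := fun c Z =>
    map_smul (mfderiv I 𝓘(ℝ, E) (extChartAt I x) y : E →L[ℝ] E) c Z
  rw [Function.comp_apply, coordEta, hu, ← hnorm, ← hgrad]
  exact Prod.ext rfl (hlin _ _)

end Immersion

/-- The charts of the scale bundle factor through its trivialization, so in charts the embedding is
the linear map (t, e) ↦ ((t, 0), e). -/
theorem mdifferentiableAt_scaleEmbedding [Nontrivial E] (g : RiemannianMetricOn I M) (hε : 0 < ε)
    (q : ScaleBundle g) :
    MDifferentiableAt (𝓘(ℝ, ℝ).prod I) (ambientModel I) (scaleEmbedding g hε) q := by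
  have : IsManifold (ambientModel I) 1 (Ambient ε M) := IsManifold.of_le (n := ∞) (by simp)
  let k : ℝ × E →L[ℝ] (ℝ × ℝ) × E :=
    ((ContinuousLinearMap.fst ℝ ℝ E).prod 0).prod (ContinuousLinearMap.snd ℝ ℝ E)
  refine mdifferentiableAt_of_chart (k := k) k.differentiableAt
    (Filter.Eventually.of_forall fun _ => rfl) ?_
  filter_upwards [extChartAt_source_mem_nhds (I := 𝓘(ℝ, ℝ).prod I) q] with y hy
  rw [extChartAt_source] at hy ⊢
  exact ⟨mem_chart_source (ℝ × ℝ) (scaleEmbedding g hε y).1, hy.2.2⟩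

end Main

/-! ### Transfer of the coordinate identities to the manifold. -/

section Results

variable {E : Type*} [NormedAddCommGroup E] [NormedSpace ℝ E]
  {H : Type*} [TopologicalSpace H] {I : ModelWithCorners ℝ E H} [I.Boundaryless]
  {M : Type*} [TopologicalSpace M] [ChartedSpace H M] [IsManifold I ∞ M] {ε : ℝ}
  (g : RiemannianMetricOn I M) {α : ℝ → ∀ x : M, TangentSpace I x →L[ℝ] TangentSpace I x}

theorem ambientMetric_center (p : Ambient ε M) :
    ambientMetric I g.inner α ε p =
      coordAmbient (coordFamily g.inner α p.2) (extChartAt (ambientModel I) p p) := by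
  have : IsManifold (ambientModel I) 1 (Ambient ε M) := IsManifold.of_le (n := ∞) (by simp)
  rw [← coordMetric_ambientMetric g.inner α p (mem_extChartAt_target p)]
  exact (coordMetric_center' _ p).symm

theorem coordMetric_ambientMetric_eventuallyEq (p : Ambient ε M) :
    coordMetric (ambientModel I) (ambientMetric I g.inner α ε) p
      =ᶠ[𝓝 (extChartAt (ambientModel I) p p)] coordAmbient (coordFamily g.inner α p.2) :=
  Filter.eventuallyEq_of_mem (extChartAt_target_mem_nhds p)
    fun _ hq => coordMetric_ambientMetric g.inner α p hq

variable [FiniteDimensional ℝ E]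

/-- Ricci flatness in the directions of the hypersurface `ρ = 0`. -/
theorem ricci_ambientMetric_eq_zero (hn : 3 ≤ Module.finrank ℝ E) (p : Ambient ε M)
    (hp : rhoFun p = 0)
    (hα_zero : ∀ x : M, α 0 x = ContinuousLinearMap.id ℝ (TangentSpace I x))
    (h : IsMetricFamilyAt (coordFamily g.inner α p.2) (0, extChartAt I p.2 p.2))
    (hP : paramDeriv (coordFamily g.inner α p.2) (0, extChartAt I p.2 p.2) =
      (2 : ℝ) • schouten I g.inner p.2)
    (X Y : (ℝ × ℝ) × E) (hX : X.1.2 = 0) (hY : Y.1.2 = 0) :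
    ricci (ambientModel I) (ambientMetric I g.inner α ε) p X Y = 0 := by
  have : IsManifold I 1 M := IsManifold.of_le (n := ∞) (by simp)
  have : IsManifold (ambientModel I) 1 (Ambient ε M) := IsManifold.of_le (n := ∞) (by simp)
  obtain ⟨⟨a, b⟩, v⟩ := X
  obtain ⟨⟨a', b'⟩, v'⟩ := Y
  obtain rfl : b = 0 := hX
  obtain rfl : b' = 0 := hY
  have ht : tFun p ≠ 0 := (p.1.2.1 : 0 < (p.1 : ℝ × ℝ).1).ne'
  have hpt : extChartAt (ambientModel I) p p = ((tFun p, 0), extChartAt I p.2 p.2) := by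
    rw [← hp]; rfl
  rw [schouten_eq_coordSchouten, ← coordFamily_zero hα_zero] at hP
  have h1 := coordRicci_coordAmbient_eq_zero hn ht h hP a a' v v'
  rw [← hpt, ← coordRicci_congr (coordMetric_ambientMetric_eventuallyEq g p)] at h1
  rw [ricci_eq_coordRicci]
  exact h1

/-- The Weingarten endomorphism represents the Schouten tensor of the conformal metric. -/
theorem schouten_conformal_eq_weingarten (hn : 3 ≤ Module.finrank ℝ E) (hε : 0 < ε)
    (u : C^∞⟮I, M; ℝ⟯) (x : M)
    (hα_zero : ∀ x : M, α 0 x = ContinuousLinearMap.id ℝ (TangentSpace I x))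
    (h : ∀ e ∈ (extChartAt I x).target, IsMetricFamilyAt (coordFamily g.inner α x) (0, e))
    (hP : paramDeriv (coordFamily g.inner α x) (0, extChartAt I x x) =
      (2 : ℝ) • schouten I g.inner x)
    (v w : TangentSpace I x) :
    schouten I (conformal g u).inner x v w =
      (conformal g u).inner x (weingarten I (ambientModel I) (ambientMetric I g.inner α ε)
        (immersion hε u) (eta I g.inner hε u) x v) w := by
  have : IsManifold I 1 M := IsManifold.of_le (n := ∞) (by simp)
  have : IsManifold (ambientModel I) 1 (Ambient ε M) := IsManifold.of_le (n := ∞) (by simp)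
  have : CompleteSpace E := FiniteDimensional.complete ℝ E
  set p : Ambient ε M := immersion hε u x with hp
  set f : E → ℝ := u ∘ (extChartAt I x).symm with hf
  set γ := coordFamily g.inner α x with hγ
  set e := extChartAt I x x with he
  have heT : e ∈ (extChartAt I x).target := mem_extChartAt_target x
  have hγ0 : (fun y => γ (0, y)) = coordMetric I g.inner x := coordFamily_zero hα_zero x
  have hfe : ContDiffAt ℝ 2 f e := contDiffAt_comp_extChartAt_symm u heT
  have hfu : f e = u x := congrArg u (extChartAt_to_inv x)
  have hΦ : extChartAt (ambientModel I) p p = coordImmersion f e := extChartAt_immersion hε u x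
  have hamb : ambientMetric I g.inner α ε p = coordAmbient γ (coordImmersion f e) := by
    rw [ambientMetric_center, hΦ]
    rfl
  have hDΨ := mfderiv_immersion hε u x
  have hDΨ' := mfderiv_extChartAt_immersion hε u x
  have hηeq := eta_eventuallyEq hε u x g fun y hy => by
    rw [← congrFun hγ0 y]; exact (h y hy).isInvertible
  have hG : IsMetricAt (coordMetric I g.inner x) e := hγ0 ▸ (h e heT).isMetricAt
  have hDη : mfderiv I 𝓘(ℝ, (ℝ × ℝ) × E) (fun y => mfderiv (ambientModel I) 𝓘(ℝ, (ℝ × ℝ) × E)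
      (extChartAt (ambientModel I) p) (immersion hε u y) (eta I g.inner hε u y)) x =
      fderiv ℝ (coordEta (coordMetric I g.inner x) f) e :=
    mfderiv_eq_fderiv_of_chart (differentiableAt_coordEta hG hfe) hηeq
  -- The induced derivative becomes Dη + Γ(DΨ v, η) on the vector space, in the ambient chart at
  -- Ψ(x).
  have hind : ∀ v : E, inducedDeriv I (ambientModel I) (ambientMetric I g.inner α ε)
      (immersion hε u) (eta I g.inner hε u) x v =
      fderiv ℝ (coordEta (fun y => γ (0, y)) f) e v +
        christoffel (coordAmbient γ) (coordImmersion f e) (fderiv ℝ (coordImmersion f) e v)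
          (coordEta (fun y => γ (0, y)) f e) := by
    intro v
    rw [hγ0]
    exact inducedDeriv_eq hDη hDΨ' (hΦ ▸
      (christoffel_congr (coordMetric_ambientMetric_eventuallyEq g p)).self_of_nhds)
      hηeq.self_of_nhds v
  have hform : ∀ v w : E, compForm (ambientMetric I g.inner α ε p)
      (inducedDeriv I (ambientModel I) (ambientMetric I g.inner α ε)
        (immersion hε u) (eta I g.inner hε u) x)
      (mfderiv I (ambientModel I) (immersion hε u) x) v w =
      -schouten I (conformal g u).inner x v w := by
    intro v w
    rw [schouten_eq_coordSchouten]
    have h1 := coordAmbient_covariantDeriv_coordEta_eq hn (h e heT) hfe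
      (by rw [hP, schouten_eq_coordSchouten, hγ0]; rfl) v w
    rw [← hind v, ← hamb, ← hDΨ] at h1
    refine h1.trans ?_
    have h2 : coordMetric I (conformal g u).inner x = fun y => Real.exp (2 * f y) • γ (0, y) := by
      funext y
      rw [congrFun hγ0 y]
      rfl
    rw [h2]
    rfl
  -- The immersion induces e^{2u} g, so the form used to raise the index in `weingarten` is the one
  -- in the claim; the two minus signs then cancel.
  have hpull : pullback I (ambientModel I) (immersion hε u) (ambientMetric I g.inner α ε) x =
      (conformal g u).inner x := by
    refine ContinuousLinearMap.ext fun v => ContinuousLinearMap.ext fun w => ?_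
    have h1 := coordAmbient_fderiv_coordImmersion (γ := γ) (hfe.differentiableAt (by simp)) v w
    rw [← hamb, ← hDΨ] at h1
    refine h1.trans ?_
    rw [congrFun hγ0 e, coordMetric_center g.inner x v w, hfu]
    rfl
  have h1 := neg_raise_apply (E := E) (metric_isInvertible (conformal g u) x)
    (compForm (ambientMetric I g.inner α ε p)
      (inducedDeriv I (ambientModel I) (ambientMetric I g.inner α ε)
        (immersion hε u) (eta I g.inner hε u) x)
      (mfderiv I (ambientModel I) (immersion hε u) x)) v w
  rw [weingarten, hpull]
  exact (h1.trans ((congrArg Neg.neg (hform v w)).trans (neg_neg _))).symm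

end Results
end ConformalAmbient

theorem theorem5p7 (n : ℕ) [Fact (3 ≤ n)]
    {M : Type*} [TopologicalSpace M] [T2Space M] [SecondCountableTopology M]
    [ChartedSpace (EuclideanSpace ℝ (Fin n)) M] [IsManifold (𝓡 n) ∞ M]
    (g : RiemannianMetricOn (𝓡 n) M)
    (ε : ℝ) (hε : 0 < ε)
    (α : ℝ → ∀ x : M, TangentSpace (𝓡 n) x →L[ℝ] TangentSpace (𝓡 n) x)
    (hα_smooth : ContMDiffOn (𝓘(ℝ, ℝ).prod (𝓡 n))
      ((𝓡 n).prod 𝓘(ℝ, EuclideanSpace ℝ (Fin n) →L[ℝ] EuclideanSpace ℝ (Fin n))) ∞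
      (fun p : ℝ × M => TotalSpace.mk' (EuclideanSpace ℝ (Fin n) →L[ℝ] EuclideanSpace ℝ (Fin n))
        (E := fun x : M => TangentSpace (𝓡 n) x →L[ℝ] TangentSpace (𝓡 n) x) p.2 (α p.1 p.2))
      (Ioo (-ε) ε ×ˢ univ))
    (hα_symm : ∀ ρ ∈ Ioo (-ε) ε, ∀ (x : M) (v w : TangentSpace (𝓡 n) x),
      g.inner x (α ρ x v) w = g.inner x v (α ρ x w))
    (hα_pos : ∀ ρ ∈ Ioo (-ε) ε, ∀ (x : M) (v : TangentSpace (𝓡 n) x), v ≠ 0 →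
      0 < g.inner x (α ρ x v) v)
    (hα_zero : ∀ x : M, α 0 x = ContinuousLinearMap.id ℝ (TangentSpace (𝓡 n) x))
    (hα_deriv : ∀ (x : M) (v : TangentSpace (𝓡 n) x), HasDerivAt (fun ρ => α ρ x v)
      ((2 : ℝ) • raise (g.inner x) (schouten (𝓡 n) g.inner x) v) 0) :
    (∀ (u : C^∞⟮𝓡 n, M; ℝ⟯) (x : M) (v w : TangentSpace (𝓡 n) x),
      schouten (𝓡 n) (conformal g u).inner x v w =
        (conformal g u).inner x
          (weingarten (𝓡 n) (ambientModel (𝓡 n)) (ambientMetric (𝓡 n) g.inner α ε)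
            (immersion hε u) (eta (𝓡 n) g.inner hε u) x v) w) ∧
    (∀ (q : ScaleBundle g) (ξ ζ : TangentSpace (𝓘(ℝ, ℝ).prod (𝓡 n)) q),
      ricci (ambientModel (𝓡 n)) (ambientMetric (𝓡 n) g.inner α ε) (scaleEmbedding g hε q)
        (mfderiv (𝓘(ℝ, ℝ).prod (𝓡 n)) (ambientModel (𝓡 n)) (scaleEmbedding g hε) q ξ)
        (mfderiv (𝓘(ℝ, ℝ).prod (𝓡 n)) (ambientModel (𝓡 n)) (scaleEmbedding g hε) q ζ) = 0) := by
  have hn : 3 ≤ Module.finrank ℝ (EuclideanSpace ℝ (Fin n)) := by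
    rw [finrank_euclideanSpace_fin]; exact Fact.out
  have h : ∀ (x : M), ∀ e ∈ (extChartAt (𝓡 n) x).target,
      IsMetricFamilyAt (coordFamily g.inner α x) (0, e) := fun x e he =>
    isMetricFamilyAt_coordFamily g isOpen_Ioo hα_smooth hα_symm hα_pos x ⟨⟨by simpa, hε⟩, he⟩
  have hP : ∀ x : M, paramDeriv (coordFamily g.inner α x) (0, extChartAt (𝓡 n) x x) =
      (2 : ℝ) • schouten (𝓡 n) g.inner x := fun x =>
    paramDeriv_coordFamily g (hα_deriv x) (h x _ (mem_extChartAt_target x))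
  refine ⟨fun u x v w => schouten_conformal_eq_weingarten g hn hε u x hα_zero (h x) (hP x) v w,
    fun q ξ ζ => ?_⟩
  -- Since ρ vanishes identically on the image, the differential of the embedding has no
  -- ρ-component, as the Ricci computation requires.
  have hρ : ∀ q : ScaleBundle g, rhoFun (scaleEmbedding g hε q) = 0 := fun _ => rfl
  have hd := mdifferentiableAt_scaleEmbedding g hε q
  exact ricci_ambientMetric_eq_zero g hn _ (hρ q) hα_zero (h _ _ (mem_extChartAt_target _)) (hP _)
    _ _ (mfderiv_fst_snd_eq_zero hρ hd ξ) (mfderiv_fst_snd_eq_zero hρ hd ζ)
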